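/- Let $N\ge 1$ and $\kappa>1$. There is a constant $c>0$, depending only on $N$ and $\kappa$, such that the following holds for all $1<p<\infty$ and all $0<R_1<R_2$ with $R_2/R_1=\kappa$. Let $u\in L^p(\mathbb{R}^N)$ be real-valued with $\operatorname{Supp}\widehat u\subset\{\xi\in\mathbb{R}^N : R_1\le|\xi|\le R_2\}$, where $\widehat u(\xi)=\int e^{-ix\cdot\xi}u(x)\,dx$ in the sense of tempered distributions. Then $u$ agrees almost everywhere with a $C^\infty$ function, again denoted by $u$, and for every bounded measurable function $a:\mathbb{R}^N\to\mathbb{R}$ and every constant $a_*>0$ with $a\ge a_*$ almost everywhere, the functions $|u|^p$ and $a|\nabla u|^2|u|^{p-2}$ are integrable and $$c\,a_*\Bigl(\frac{p-1}{p^2}\Bigr)R_1^2\int_{\mathbb{R}^N}|u|^p\,dx\;\le\;(p-1)\int_{\mathbb{R}^N}a|\nabla u|^2|u|^{p-2}\,dx\;=\;-\int_{\mathbb{R}^N}\operatorname{div}(a\nabla u)\,|u|^{p-2}u\,dx .$$ In the last integral $\operatorname{div}(a\nabla u)$ is the distribution $\langle\operatorname{div}(a\nabla u),\varphi\rangle=-\int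 a\nabla u\cdot\nabla\varphi\,dx$, $\varphi\in C_c^\infty(\mathbb{R}^N)$, and the integral is its extension by continuity to $v=|u|^{p-2}u$. That is, there are $\varphi_n\in C_c^\infty(\mathbb{R}^N)$ with $\varphi_n\to v$ in $L^{p/(p-1)}$ and $\int|a\nabla u|\,|\nabla\varphi_n-\nabla\varphi_m|\,dx\to0$ as $m,n\to\infty$, and for every such sequence $\langle\operatorname{div}(a\nabla u),\varphi_n\rangle$ converges to the same value, which is denoted by $\int\operatorname{div}(a\nabla u)\,v\,dx$. Moreover, whenever $\operatorname{div}(a\nabla u)$ is a locally integrable function $g$ for which $g\,|u|^{p-2}u$ is integrable, the equality also holds with the Lebesgue integral $\int g\,|u|^{p-2}u\,dx$ on the right. -/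

import Mathlib

open MeasureTheory Filter Topology
open scoped ENNReal ContDiff Gradient FourierTransform SchwartzMap

/-- The complex tempered distribution `φ ↦ ∫ φ u` defined by a real function `u ∈ L^p(ℝ^N)`. -/
noncomputable def lpDistribution {N : ℕ} {p : ℝ} (hp : 1 < p)
    (u : EuclideanSpace ℝ (Fin N) → ℝ) (hu : MemLp u (ENNReal.ofReal p) volume) :
    𝓢'(EuclideanSpace ℝ (Fin N), ℂ) :=
  haveI : Fact (1 ≤ ENNReal.ofReal p) := ⟨by simpa using hp.le⟩
  Lp.toTemperedDistribution (MemLp.toLp (fun x => (u x : ℂ)) hu.ofReal)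

/-- Sanity check: the action of `lpDistribution` on a Schwartz function. -/
theorem lpDistribution_apply {N : ℕ} {p : ℝ} (hp : 1 < p)
    (u : EuclideanSpace ℝ (Fin N) → ℝ) (hu : MemLp u (ENNReal.ofReal p) volume)
    (φ : 𝓢(EuclideanSpace ℝ (Fin N), ℂ)) :
    lpDistribution hp u hu φ = ∫ x, φ x * (u x : ℂ) := by
  have : Fact (1 ≤ ENNReal.ofReal p) := ⟨by simpa using hp.le⟩
  rw [lpDistribution, Lp.toTemperedDistribution_apply]
  refine integral_congr_ae ?_
  filter_upwards [MemLp.coeFn_toLp (μ := volume) (p := ENNReal.ofReal p)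
    (f := fun x => (u x : ℂ)) hu.ofReal] with x hx
  rw [hx, smul_eq_mul]

/-- The Fourier support of a tempered distribution (as a set of Mathlib frequencies `η`). -/
noncomputable def fourierSupport {N : ℕ} (T : 𝓢'(EuclideanSpace ℝ (Fin N), ℂ)) :
    Set (EuclideanSpace ℝ (Fin N)) :=
  Distribution.dsupport (𝓕 T : 𝓢'(EuclideanSpace ℝ (Fin N), ℂ))

/-- The annulus `R₁ ≤ |ξ| ≤ R₂` of angular frequencies. Mathlib's Fourier transform has the kernel
`exp (-2πi ⟨x, η⟩)`, so that its variable `η` corresponds to the angular frequency `ξ = 2πη`. -/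
def frequencyAnnulus (N : ℕ) (R₁ R₂ : ℝ) : Set (EuclideanSpace ℝ (Fin N)) :=
  {η | R₁ ≤ 2 * Real.pi * ‖η‖ ∧ 2 * Real.pi * ‖η‖ ≤ R₂}

/-- `φ` is a real test function on `ℝ^N`: smooth with compact support. -/
def IsTestFun {N : ℕ} (φ : EuclideanSpace ℝ (Fin N) → ℝ) : Prop :=
  ContDiff ℝ ∞ φ ∧ HasCompactSupport φ

/-- The action `⟨div F, φ⟩ = -∫ F · ∇φ` of the distribution `div F` on a test function `φ`. -/
noncomputable def divAction {N : ℕ}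
    (F : EuclideanSpace ℝ (Fin N) → EuclideanSpace ℝ (Fin N))
    (φ : EuclideanSpace ℝ (Fin N) → ℝ) : ℝ :=
  -∫ x, inner ℝ (F x) (∇ φ x)

/-- The distribution `div F` is the locally integrable function `g`. -/
def IsDistribDiv {N : ℕ}
    (F : EuclideanSpace ℝ (Fin N) → EuclideanSpace ℝ (Fin N))
    (g : EuclideanSpace ℝ (Fin N) → ℝ) : Prop :=
  LocallyIntegrable g volume ∧ ∀ φ, IsTestFun φ → ∫ x, g x * φ x = divAction F φ

/-- The test functions `φ n` approximate `v`: they converge to `v` in `L^q` and are Cauchy for the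
seminorm `φ ↦ ∫ |F| |∇φ|`, for which the functional `φ ↦ ⟨div F, φ⟩` is continuous. -/
def IsDivApprox {N : ℕ}
    (F : EuclideanSpace ℝ (Fin N) → EuclideanSpace ℝ (Fin N)) (q : ℝ≥0∞)
    (v : EuclideanSpace ℝ (Fin N) → ℝ) (φ : ℕ → EuclideanSpace ℝ (Fin N) → ℝ) : Prop :=
  (∀ n, IsTestFun (φ n)) ∧
  Tendsto (fun n => eLpNorm (φ n - v) q volume) atTop (𝓝 0) ∧
  Tendsto (fun mn : ℕ × ℕ => ∫⁻ x, ‖F x‖ₑ * ‖∇ (φ mn.1) x - ∇ (φ mn.2) x‖ₑ)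
    (atTop ×ˢ atTop) (𝓝 0)

/-- `∫ (div F) v = ℓ`, where `div F` is a distribution and `v ∈ L^q` need not be a test function:
`v` can be approximated by test functions as above, and for every such approximation `φ`,
`⟨div F, φ n⟩` tends to `ℓ`. By the existence of an approximation, at most one `ℓ` qualifies. -/
def HasDivPairing {N : ℕ}
    (F : EuclideanSpace ℝ (Fin N) → EuclideanSpace ℝ (Fin N)) (q : ℝ≥0∞)
    (v : EuclideanSpace ℝ (Fin N) → ℝ) (ℓ : ℝ) : Prop :=
  (∃ φ, IsDivApprox F q v φ) ∧
  ∀ φ, IsDivApprox F q v φ → Tendsto (fun n => divAction F (φ n)) atTop (𝓝 ℓ)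

/-! Write w for the smooth representative, X = ∫|w|^p and A = ∫|∇w|²|w|^(p-2). Since the spectrum
avoids a ball around the origin, there is a smooth Fourier cutoff, equal to 1 near the annulus, that
is divisible by -4π²|η|². Hence w = div (G * w), with G the gradient of a Schwartz function, and
scaling gives ‖G_j‖₁ ≤ b = C/R₁ with C depending only on N and κ (`exists_reproducing_kernel`).

The core is the Poincaré-type inequality X ≤ p²(Nb)²A (`integral_rpow_le_energy`). For p ≥ 2, the
field V = G * w satisfies ‖V_j‖_p ≤ b‖w‖_p by Young's inequality, and X = ∫|w|^(p-2) w div V =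
-(p-1)∫|w|^(p-2) ∇w·V is controlled by A and X through Cauchy–Schwarz and Hölder. For p < 2 the
weight |w|^(p-2) is singular, so the derivative is put on w instead: w = ∑ G_j * ∂_j w, and ∫|∂_j
w|^p is interpolated between A and X. In both cases X is absorbed on the left.

The technical difficulty is that |s|^(p-2)s need not be differentiable at 0. It is replaced by
smooth truncations vanishing near 0, composed with w and cut off in space (`exists_testFun_approx`);
limits are identified because ∇w = 0 almost everywhere on {w = 0} (`ae_pd_eq_zero_of_eq_zero`).
Fatou's lemma applied to ∫∇φ_n·∇w = -∫φ_n Δw shows that A is finite (`integrable_energy`).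

For the equality, a is only bounded and measurable, so a∇w cannot be differentiated classically.
Along any approximating sequence, a ≥ a_* makes ∇w·∇φ_n Cauchy in L¹. Testing the limit against a
smooth ψ involves only derivatives of ψ∇w and identifies it as (p-1)|w|^(p-2)|∇w|²; multiplication
by the bounded a is then continuous in L¹ (`IsDivApprox.tendsto_divAction`). -/

/-! ### Supports of tempered distributions. -/

/-- A tempered distribution annihilates the compactly supported Schwartz functions whose support
avoids the support of the distribution. -/
theorem tempered_apply_eq_zero_of_hasCompactSupport {E : Type*} [NormedAddCommGroup E]
    [NormedSpace ℝ E] [FiniteDimensional ℝ E] (T : 𝓢'(E, ℂ)) (f : 𝓢(E, ℂ))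
    (hc : HasCompactSupport f) (hf : Disjoint (tsupport f) (Distribution.dsupport T)) :
    T f = 0 := by
  have h1 : ∀ x ∈ tsupport f, ∃ s : Set E, Distribution.IsVanishingOn T s ∧ IsOpen s ∧ x ∈ s := by
    intro x hx
    have : x ∉ Distribution.dsupport T := fun h => Set.disjoint_left.1 hf hx h
    simpa using this
  choose! s hs ho hxs using h1
  -- Finitely many open sets on which `T` vanishes cover the compact support of `f`; a subordinate
  -- smooth partition of unity splits `f` into pieces, each supported in one of them.
  obtain ⟨t, hts, htK⟩ := hc.isCompact.elim_nhds_subcover s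
    (fun x hx => (ho x hx).mem_nhds (hxs x hx))
  obtain ⟨ρ, hρ⟩ := SmoothPartitionOfUnity.exists_isSubordinate (modelWithCornersSelf ℝ E)
    (isClosed_tsupport f) (fun i : t => s i.1) (fun i => ho _ (hts _ i.2)) (by
      intro x hx
      have := htK hx
      simp only [Set.mem_iUnion] at this ⊢
      obtain ⟨i, hi, hx⟩ := this
      exact ⟨⟨i, hi⟩, hx⟩)
  have hsm : ∀ i : t, ContDiff ℝ ∞ (fun x => (ρ i x : ℂ) * f x) := fun i =>
    (Complex.ofRealCLM.contDiff.comp (ρ i).contMDiff.contDiff).mul (f.smooth ⊤)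
  have hcs : ∀ i : t, HasCompactSupport (fun x => (ρ i x : ℂ) * f x) := fun i => hc.mul_left
  have hsum : f = ∑ i : t, (hcs i).toSchwartzMap (hsm i) := by
    ext x
    simp only [FunLike.coe_sum, Finset.sum_apply]
    change f x = ∑ i : t, (ρ i x : ℂ) * f x
    rw [← Finset.sum_mul]
    by_cases hx : x ∈ tsupport f
    · have := ρ.sum_eq_one hx
      rw [finsum_eq_sum_of_fintype] at this
      rw [← Complex.ofReal_sum, this]; simp
    · rw [image_eq_zero_of_notMem_tsupport hx]; simp
  rw [hsum, map_sum]
  refine Finset.sum_eq_zero fun i _ => hs _ (hts _ i.2) _ ?_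
  refine subset_trans ?_ (hρ i)
  refine closure_mono ?_
  intro x hx
  have : (ρ i x : ℂ) * f x ≠ 0 := hx
  simp at this
  simp [this.1]

/-- Dilated cutoffs of a Schwartz function converge to it in the Schwartz topology. -/
theorem exists_seq_hasCompactSupport_tendsto_schwartz {E : Type*} [NormedAddCommGroup E]
    [NormedSpace ℝ E] [FiniteDimensional ℝ E] (f : 𝓢(E, ℂ)) :
    ∃ g : ℕ → 𝓢(E, ℂ), (∀ n, HasCompactSupport (g n)) ∧ (∀ n, tsupport (g n) ⊆ tsupport f) ∧
      Tendsto g atTop (𝓝 f) := by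
  obtain ⟨χ, h1, h2⟩ : ∃ χ : ContDiffBump (0 : E), χ.rIn = 1 ∧ χ.rOut = 2 :=
    ⟨⟨1, 2, one_pos, one_lt_two⟩, rfl, rfl⟩
  set c : ℕ → ℝ := fun n => ((n : ℝ) + 1)⁻¹ with hc
  have hcpos : ∀ n, 0 < c n := fun n => by positivity
  have hcle : ∀ n, c n ≤ 1 := fun n => inv_le_one_of_one_le₀ (by simp)
  have hχ : ContDiff ℝ ∞ (χ : E → ℝ) := χ.contDiff
  have hsm : ∀ n, ContDiff ℝ ∞ (fun x => χ (c n • x) • f x) := fun n =>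
    (hχ.comp (contDiff_const_smul (c n))).smul (f.smooth ⊤)
  have hcs : ∀ n, HasCompactSupport (fun x => χ (c n • x) • f x) := fun n => by
    have : HasCompactSupport (fun x => χ (c n • x)) :=
      χ.hasCompactSupport.comp_homeomorph (Homeomorph.smulOfNeZero (c n) (hcpos n).ne')
    exact this.smul_right
  refine ⟨fun n => (hcs n).toSchwartzMap (hsm n), hcs, fun n => ?_, ?_⟩
  · exact tsupport_smul_subset_right _ _
  · have hbd : ∀ i : ℕ, ∃ M : ℝ, 0 ≤ M ∧ ∀ x, ‖iteratedFDeriv ℝ i (fun y => 1 - χ y) x‖ ≤ M := by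
      intro i
      have hcont : Continuous (iteratedFDeriv ℝ i (χ : E → ℝ)) :=
        hχ.continuous_iteratedFDeriv (by exact_mod_cast le_top)
      obtain ⟨M, hM⟩ := hcont.bounded_above_of_compact_support (χ.hasCompactSupport.iteratedFDeriv i)
      have hM0 : 0 ≤ M := (norm_nonneg _).trans (hM 0)
      refine ⟨1 + M, by positivity, fun x => ?_⟩
      have : (fun y => 1 - χ y) = (fun _ : E => (1 : ℝ)) - (χ : E → ℝ) := rfl
      rw [this, iteratedFDeriv_sub_apply contDiff_const.contDiffAt
        ((hχ.of_le (by exact_mod_cast le_top)).contDiffAt)]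
      refine (norm_sub_le _ _).trans (add_le_add ?_ (hM x))
      rcases Nat.eq_zero_or_pos i with rfl | hi
      · simp
      · rw [iteratedFDeriv_const_of_ne hi.ne']; simp
    choose M hM0 hM using hbd
    rw [(schwartz_withSeminorms ℝ E ℂ).tendsto_nhds]
    rintro ⟨k, m⟩ ε hε
    set C : ℝ := ∑ i ∈ Finset.range (m + 1), (m.choose i : ℝ) * M i *
      SchwartzMap.seminorm ℝ (k + 1) (m - i) f with hC
    have hC0 : 0 ≤ C := Finset.sum_nonneg fun i _ =>
      mul_nonneg (mul_nonneg (by positivity) (hM0 i)) (apply_nonneg _ _)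
    have hlim : Tendsto (fun n => c n * C) atTop (𝓝 0) := by
      have := (tendsto_one_div_add_atTop_nhds_zero_nat (𝕜 := ℝ)).mul_const C
      simpa [hc] using this
    filter_upwards [hlim.eventually (gt_mem_nhds hε)] with n hn
    refine lt_of_le_of_lt ?_ hn
    rw [SchwartzMap.schwartzSeminormFamily_apply, ← map_neg_eq_map, neg_sub]
    refine SchwartzMap.seminorm_le_bound ℝ k m _ (mul_nonneg (hcpos n).le hC0) fun x => ?_
    have hfun : ((f - (hcs n).toSchwartzMap (hsm n) : 𝓢(E, ℂ)) : E → ℂ)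
        = fun x => (1 - χ (c n • x)) • f x := by
      ext x
      change f x - χ (c n • x) • f x = _
      rw [sub_smul, one_smul]
    rw [hfun]
    -- Where `c n * ‖x‖ < 1` the difference vanishes near `x`. Elsewhere `1 ≤ c n * ‖x‖`, so one
    -- extra power of `‖x‖`, absorbed by the seminorm of weight `k + 1`, buys the small factor `c
    -- n`.
    by_cases hx : ‖c n • x‖ < 1
    · have hev : (fun x => (1 - χ (c n • x)) • f x) =ᶠ[𝓝 x] fun _ => 0 := by
        have : ∀ᶠ y in 𝓝 x, ‖c n • y‖ < 1 :=
          (continuous_const_smul (c n)).norm.continuousAt.eventually (gt_mem_nhds hx)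
        filter_upwards [this] with y hy
        rw [χ.one_of_mem_closedBall (by rw [h1]; simpa using hy.le)]
        simp
      rw [(Filter.EventuallyEq.iteratedFDeriv ℝ hev m).self_of_nhds]
      simp only [iteratedFDeriv_fun_zero]
      simp
      positivity
    · have hx1 : 1 ≤ c n * ‖x‖ := by
        rw [norm_smul, Real.norm_of_nonneg (hcpos n).le] at hx
        exact not_lt.1 hx
      have hs1 : ContDiff ℝ ∞ (fun x => 1 - χ (c n • x)) :=
        contDiff_const.sub (hχ.comp (contDiff_const_smul (c n)))
      have key := norm_iteratedFDeriv_smul_le (𝕜 := ℝ) hs1 (f.smooth ⊤) x (n := m)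
        (by exact_mod_cast le_top)
      calc ‖x‖ ^ k * ‖iteratedFDeriv ℝ m (fun x => (1 - χ (c n • x)) • f x) x‖
          ≤ ‖x‖ ^ k * ∑ i ∈ Finset.range (m + 1), (m.choose i : ℝ) *
            ‖iteratedFDeriv ℝ i (fun x => 1 - χ (c n • x)) x‖ *
            ‖iteratedFDeriv ℝ (m - i) f x‖ := by gcongr
        _ = ∑ i ∈ Finset.range (m + 1), (m.choose i : ℝ) *
            ‖iteratedFDeriv ℝ i (fun x => 1 - χ (c n • x)) x‖ *
            (‖x‖ ^ k * ‖iteratedFDeriv ℝ (m - i) f x‖) := by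
          rw [Finset.mul_sum]; exact Finset.sum_congr rfl fun i _ => by ring
        _ ≤ ∑ i ∈ Finset.range (m + 1), (m.choose i : ℝ) * M i *
            (c n * SchwartzMap.seminorm ℝ (k + 1) (m - i) f) := by
          refine Finset.sum_le_sum fun i _ => ?_
          have e1 : ‖iteratedFDeriv ℝ i (fun x => 1 - χ (c n • x)) x‖ ≤ M i := by
            have hcd : ContDiff ℝ i (fun y => 1 - χ y) :=
              (contDiff_const.sub hχ).of_le (by exact_mod_cast le_top)
            have := congrFun (iteratedFDeriv_comp_const_smul (c n) hcd) x
            rw [this, norm_smul, norm_pow, Real.norm_of_nonneg (hcpos n).le]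
            calc c n ^ i * _ ≤ 1 * M i := by
                  gcongr
                  · exact pow_le_one₀ (hcpos n).le (hcle n)
                  · exact hM i _
              _ = M i := one_mul _
          have e2 : ‖x‖ ^ k * ‖iteratedFDeriv ℝ (m - i) f x‖
              ≤ c n * SchwartzMap.seminorm ℝ (k + 1) (m - i) f := by
            calc ‖x‖ ^ k * ‖iteratedFDeriv ℝ (m - i) f x‖
                ≤ (c n * ‖x‖) * (‖x‖ ^ k * ‖iteratedFDeriv ℝ (m - i) f x‖) :=
                  le_mul_of_one_le_left (by positivity) hx1
              _ = c n * (‖x‖ ^ (k + 1) * ‖iteratedFDeriv ℝ (m - i) f x‖) := by ring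
              _ ≤ _ := by
                gcongr
                exact SchwartzMap.le_seminorm ℝ (k + 1) (m - i) f x
          gcongr
          exact mul_nonneg (by positivity) (hM0 i)
        _ = c n * C := by
          rw [hC, Finset.mul_sum]; exact Finset.sum_congr rfl fun i _ => by ring

/-- A tempered distribution annihilates the Schwartz functions whose support avoids the support of
the distribution. -/
theorem tempered_apply_eq_zero {E : Type*} [NormedAddCommGroup E]
    [NormedSpace ℝ E] [FiniteDimensional ℝ E] (T : 𝓢'(E, ℂ)) (f : 𝓢(E, ℂ))
    (hf : Disjoint (tsupport f) (Distribution.dsupport T)) : T f = 0 := by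
  obtain ⟨g, hgc, hgs, hg⟩ := exists_seq_hasCompactSupport_tendsto_schwartz f
  refine tendsto_nhds_unique ((T.continuous.tendsto f).comp hg) ?_
  refine tendsto_const_nhds.congr fun n => ?_
  exact (tempered_apply_eq_zero_of_hasCompactSupport T (g n) (hgc n) (hf.mono_left (hgs n))).symm

/-! ### Young's convolution inequality. -/

/-- Young's convolution inequality `L¹ * L^p ⊆ L^p` for nonnegative functions. -/
theorem lintegral_convolution_rpow_le {E : Type*} [NormedAddCommGroup E]
    [MeasurableSpace E] [BorelSpace E] [SecondCountableTopology E] {μ : Measure E} [SFinite μ]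
    [μ.IsAddLeftInvariant] [μ.IsNegInvariant] {p : ℝ} (hp : 1 < p) {f g : E → ℝ≥0∞}
    (hf : Measurable f) (hg : AEMeasurable g μ) :
    ∫⁻ x, (∫⁻ y, f (x - y) * g y ∂μ) ^ p ∂μ ≤ (∫⁻ x, f x ∂μ) ^ p * ∫⁻ x, g x ^ p ∂μ := by
  have hp0 : 0 < p := by linarith
  have hpq := Real.HolderConjugate.conjExponent hp
  set q := p.conjExponent
  have hI : ∀ x, ∫⁻ y, f (x - y) ∂μ = ∫⁻ y, f y ∂μ := fun x => lintegral_sub_left_eq_self f x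
  have hfx : ∀ x, Measurable fun y => f (x - y) := fun x => hf.comp (measurable_const.sub measurable_id)
  -- Hölder after splitting f = f^(1/q) f^(1/p); Tonelli then integrates the second factor in x.
  have hpt : ∀ x, (∫⁻ y, f (x - y) * g y ∂μ) ^ p
      ≤ (∫⁻ y, f y ∂μ) ^ (p / q) * ∫⁻ y, f (x - y) * g y ^ p ∂μ := by
    intro x
    have h := ENNReal.lintegral_mul_le_Lp_mul_Lq μ hpq.symm
      (f := fun y => f (x - y) ^ (1 / q)) (g := fun y => f (x - y) ^ (1 / p) * g y)
      ((hfx x).pow_const _).aemeasurable (((hfx x).pow_const _).aemeasurable.mul hg)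
    have e1 : ∀ y, ((fun y => f (x - y) ^ (1 / q)) * fun y => f (x - y) ^ (1 / p) * g y) y
        = f (x - y) * g y := by
      intro y
      simp only [Pi.mul_apply]
      rw [← mul_assoc, ← ENNReal.rpow_add_of_nonneg _ _ (by simpa using hpq.symm.nonneg)
        (by positivity)]
      rw [show 1 / q + 1 / p = 1 by simpa using hpq.symm.inv_add_inv_eq_one, ENNReal.rpow_one]
    have e2 : ∀ y, (f (x - y) ^ (1 / q)) ^ q = f (x - y) := fun y => by
      rw [← ENNReal.rpow_mul, one_div_mul_cancel hpq.symm.ne_zero, ENNReal.rpow_one]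
    have e3 : ∀ y, (f (x - y) ^ (1 / p) * g y) ^ p = f (x - y) * g y ^ p := fun y => by
      rw [ENNReal.mul_rpow_of_nonneg _ _ hp0.le, ← ENNReal.rpow_mul,
        one_div_mul_cancel hp0.ne', ENNReal.rpow_one]
    simp_rw [e1, e2, e3, hI] at h
    calc _ ≤ ((∫⁻ y, f y ∂μ) ^ (1 / q) * (∫⁻ y, f (x - y) * g y ^ p ∂μ) ^ (1 / p)) ^ p := by
          gcongr
      _ = _ := by
        rw [ENNReal.mul_rpow_of_nonneg _ _ hp0.le, ← ENNReal.rpow_mul, ← ENNReal.rpow_mul,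
          one_div_mul_cancel hp0.ne', ENNReal.rpow_one]
        congr 2; ring
  have hprod : AEMeasurable (fun z : E × E => f (z.1 - z.2) * g z.2 ^ p) (μ.prod μ) :=
    (hf.comp (measurable_fst.sub measurable_snd)).aemeasurable.mul
      ((hg.comp_snd).pow_const p)
  calc ∫⁻ x, (∫⁻ y, f (x - y) * g y ∂μ) ^ p ∂μ
      ≤ ∫⁻ x, (∫⁻ y, f y ∂μ) ^ (p / q) * ∫⁻ y, f (x - y) * g y ^ p ∂μ ∂μ :=
        lintegral_mono hpt
    _ = (∫⁻ y, f y ∂μ) ^ (p / q) * ∫⁻ x, ∫⁻ y, f (x - y) * g y ^ p ∂μ ∂μ :=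
        lintegral_const_mul'' _ hprod.lintegral_prod_right'
    _ = (∫⁻ y, f y ∂μ) ^ (p / q) * ∫⁻ y, ∫⁻ x, f (x - y) * g y ^ p ∂μ ∂μ := by
        rw [lintegral_lintegral_swap hprod]
    _ = (∫⁻ y, f y ∂μ) ^ (p / q) * ∫⁻ y, (∫⁻ x, f x ∂μ) * g y ^ p ∂μ := by
        congr 1
        refine lintegral_congr fun y => ?_
        rw [lintegral_mul_const _ (show Measurable fun x => f (x - y) from
          hf.comp (measurable_id.sub measurable_const))]
        congr 1
        exact lintegral_sub_right_eq_self f y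
    _ = (∫⁻ y, f y ∂μ) ^ (p / q) * ((∫⁻ y, f y ∂μ) * ∫⁻ y, g y ^ p ∂μ) := by
        rw [lintegral_const_mul'' _ (hg.pow_const p)]
    _ = _ := by
        rw [← mul_assoc]
        congr 1
        nth_rewrite 2 [← ENNReal.rpow_one (∫⁻ y, f y ∂μ)]
        rw [← ENNReal.rpow_add_of_nonneg _ _ (div_nonneg hp0.le hpq.symm.nonneg) zero_le_one]
        congr 1
        have := hpq.symm.inv_add_inv_eq_one
        have : p / q = p * (1 - p⁻¹) := by rw [div_eq_mul_inv]; congr 1; linarith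
        rw [this]; field_simp; ring

/-! ### Convolution of a Schwartz kernel with an L^p function. -/

section SchwartzConvolution

variable {E : Type} [NormedAddCommGroup E] [InnerProductSpace ℝ E] [FiniteDimensional ℝ E]
  [MeasurableSpace E] [BorelSpace E] {F : Type} [NormedAddCommGroup F] [NormedSpace ℝ F]

/-- The convolution of a Schwartz function with a real function. -/
noncomputable def schwartzConv (K : 𝓢(E, F)) (u : E → ℝ) (x : E) : F := ∫ y, u y • K (x - y)

theorem integrable_schwartzConv {p : ℝ} (hp : 1 < p) {u : E → ℝ}
    (hu : MemLp u (ENNReal.ofReal p)) (K : 𝓢(E, F)) (x : E) :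
    Integrable fun y => u y • K (x - y) := by
  have hpq := (Real.HolderConjugate.conjExponent hp).ennrealOfReal
  have hK : MemLp (fun y => K (x - y)) (ENNReal.ofReal p.conjExponent) :=
    (K.memLp (ENNReal.ofReal p.conjExponent)).comp_measurePreserving
      (Measure.measurePreserving_sub_left volume x)
  exact memLp_one_iff_integrable.1 (hK.smul hu)

/-- Differentiation under the integral sign. For z in the unit ball around x one has 1 + ‖x-y‖ ≤ 2(1
+ ‖z-y‖), so the derivative of K at z-y is at most a constant times (1 + ‖x-y‖)^(-k), uniformly in
z. The exponent k is chosen so that this power lies in the dual L^q, and Hölder makes its product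
with |u| integrable. -/
theorem hasFDerivAt_schwartzConv {p : ℝ} (hp : 1 < p) {u : E → ℝ}
    (hu : MemLp u (ENNReal.ofReal p)) (K : 𝓢(E, F)) (x : E) :
    HasFDerivAt (schwartzConv K u) (schwartzConv (SchwartzMap.fderivCLM ℝ E F K) u x) x := by
  have hpq := (Real.HolderConjugate.conjExponent hp).ennrealOfReal
  obtain ⟨k, hk⟩ := (inferInstance : (volume : Measure E).HasTemperateGrowth).exists_eLpNorm_lt_top
    (ENNReal.ofReal p.conjExponent)
  set b : E → ℝ := fun y => (1 + ‖y‖) ^ (-k : ℝ) with hb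
  have hbc : Continuous b := by
    refine (continuous_const.add continuous_norm).rpow_const fun y => Or.inl ?_
    have : 0 < 1 + ‖y‖ := by positivity
    exact this.ne'
  have hbL : MemLp b (ENNReal.ofReal p.conjExponent) := ⟨hbc.aestronglyMeasurable, hk⟩
  have hbx : MemLp (fun y => b (x - y)) (ENNReal.ofReal p.conjExponent) :=
    hbL.comp_measurePreserving (Measure.measurePreserving_sub_left volume x)
  set C : ℝ := 2 ^ k * (Finset.Iic (k, 0)).sup
    (fun m => SchwartzMap.seminorm ℝ m.1 m.2) (SchwartzMap.fderivCLM ℝ E F K) with hC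
  have hdec : ∀ z, (1 + ‖z‖) ^ k * ‖fderiv ℝ K z‖ ≤ C := fun z => by
    have := SchwartzMap.one_add_le_sup_seminorm_apply (𝕜 := ℝ) (m := (k, 0)) le_rfl le_rfl
      (SchwartzMap.fderivCLM ℝ E F K) z
    simpa using this
  have hint : Integrable (fun y => (2 ^ k * C) * (‖u y‖ * b (x - y))) := by
    refine Integrable.const_mul ?_ _
    exact memLp_one_iff_integrable.1 (hbx.mul hu.norm)
  refine hasFDerivAt_integral_of_dominated_of_fderiv_le (s := Metric.ball x 1)
    (F := fun x y => u y • K (x - y))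
    (F' := fun x y => u y • SchwartzMap.fderivCLM ℝ E F K (x - y))
    (bound := fun y => (2 ^ k * C) * (‖u y‖ * b (x - y)))
    (Metric.ball_mem_nhds x one_pos) ?_ (integrable_schwartzConv hp hu K x) ?_ ?_ hint ?_
  · exact Eventually.of_forall fun x => (integrable_schwartzConv hp hu K x).aestronglyMeasurable
  · exact (integrable_schwartzConv hp hu _ x).aestronglyMeasurable
  · refine Eventually.of_forall fun y z hz => ?_
    rw [norm_smul, SchwartzMap.fderivCLM_apply]
    have h1 : 1 + ‖x - y‖ ≤ 2 * (1 + ‖z - y‖) := by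
      have h2 : ‖x - z‖ < 1 := by rw [← dist_eq_norm, dist_comm]; exact hz
      have h3 : ‖x - y‖ ≤ ‖x - z‖ + ‖z - y‖ := by
        simpa using norm_add_le (x - z) (z - y)
      linarith [norm_nonneg (z - y)]
    have hpos : 0 < 1 + ‖x - y‖ := by positivity
    have h4 : (1 + ‖x - y‖) ^ k * ‖fderiv ℝ K (z - y)‖ ≤ 2 ^ k * C := by
      calc _ ≤ (2 * (1 + ‖z - y‖)) ^ k * ‖fderiv ℝ K (z - y)‖ := by gcongr
        _ = 2 ^ k * ((1 + ‖z - y‖) ^ k * ‖fderiv ℝ K (z - y)‖) := by rw [mul_pow]; ring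
        _ ≤ _ := by gcongr; exact hdec _
    have h5 : ‖fderiv ℝ K (z - y)‖ ≤ 2 ^ k * C * b (x - y) := by
      rw [hb]
      simp only
      rw [Real.rpow_neg hpos.le, Real.rpow_natCast, ← div_eq_mul_inv, le_div_iff₀ (by positivity),
        mul_comm]
      exact h4
    calc ‖u y‖ * ‖fderiv ℝ K (z - y)‖ ≤ ‖u y‖ * (2 ^ k * C * b (x - y)) := by gcongr
      _ = _ := by ring
  · refine Eventually.of_forall fun y z _ => ?_
    have h := (K.differentiableAt (x := z - y)).hasFDerivAt.comp z ((hasFDerivAt_id z).sub_const y)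
    rw [ContinuousLinearMap.comp_id] at h
    exact h.const_smul (u y)

theorem contDiff_schwartzConv {p : ℝ} (hp : 1 < p) {u : E → ℝ}
    (hu : MemLp u (ENNReal.ofReal p)) (K : 𝓢(E, F)) : ContDiff ℝ ∞ (schwartzConv K u) := by
  -- The induction runs over all target spaces at once, because the derivative is a convolution
  -- whose kernel takes values in `E →L[ℝ] G`.
  have key : ∀ n : ℕ, ∀ (G : Type) [NormedAddCommGroup G] [NormedSpace ℝ G]
      (K : 𝓢(E, G)), ContDiff ℝ n (schwartzConv K u) := by
    intro n
    induction n with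
    | zero =>
      intro G _ _ K
      refine contDiff_zero.2 (continuous_iff_continuousAt.2 fun x => ?_)
      exact (hasFDerivAt_schwartzConv hp hu K x).continuousAt
    | succ n ih =>
      intro G _ _ K
      exact contDiff_succ_iff_hasFDerivAt.2 ⟨_, ih _ (SchwartzMap.fderivCLM ℝ E G K),
        hasFDerivAt_schwartzConv hp hu K⟩
  exact contDiff_infty.2 fun n => key n F K

open LineDeriv in
theorem fderiv_schwartzConv_apply {p : ℝ} (hp : 1 < p) {u : E → ℝ}
    (hu : MemLp u (ENNReal.ofReal p)) (K : 𝓢(E, F)) (x v : E) :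
    fderiv ℝ (schwartzConv K u) x v = schwartzConv (∂_{v} K) u x := by
  rw [(hasFDerivAt_schwartzConv hp hu K x).fderiv, schwartzConv,
    ContinuousLinearMap.integral_apply (integrable_schwartzConv hp hu _ x)]
  refine integral_congr_ae (Eventually.of_forall fun y => ?_)
  simp [SchwartzMap.lineDerivOp_apply_eq_fderiv]

theorem schwartzConv_congr_ae (K : 𝓢(E, F)) {u v : E → ℝ} (h : u =ᵐ[volume] v) :
    schwartzConv K u = schwartzConv K v := by
  ext x
  exact integral_congr_ae (h.mono fun y hy => by simp only [hy])

theorem lintegral_enorm_schwartzConv_rpow_le {p : ℝ} (hp : 1 < p) {u : E → ℝ}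
    (hu : AEStronglyMeasurable u) (K : 𝓢(E, F)) :
    ∫⁻ x, ‖schwartzConv K u x‖ₑ ^ p ≤ (∫⁻ x, ‖K x‖ₑ) ^ p * ∫⁻ x, ‖u x‖ₑ ^ p := by
  refine le_trans (lintegral_mono fun x => ?_)
    (lintegral_convolution_rpow_le hp (f := fun x => ‖K x‖ₑ) (g := fun x => ‖u x‖ₑ)
      K.continuous.enorm.measurable hu.enorm)
  have : ‖schwartzConv K u x‖ₑ ≤ ∫⁻ y, ‖K (x - y)‖ₑ * ‖u y‖ₑ := by
    refine (enorm_integral_le_lintegral_enorm _).trans (le_of_eq (lintegral_congr fun y => ?_))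
    rw [enorm_smul, mul_comm]
  simp only
  gcongr

theorem memLp_schwartzConv {p : ℝ} (hp : 1 < p) {u : E → ℝ}
    (hu : MemLp u (ENNReal.ofReal p)) (K : 𝓢(E, F)) :
    MemLp (schwartzConv K u) (ENNReal.ofReal p) := by
  have hp0 : 0 < p := by linarith
  have h0 : ENNReal.ofReal p ≠ 0 := by simpa using hp0
  refine ⟨(contDiff_schwartzConv hp hu K).continuous.aestronglyMeasurable, ?_⟩
  rw [eLpNorm_lt_top_iff_lintegral_rpow_enorm_lt_top h0 ENNReal.ofReal_ne_top,
    ENNReal.toReal_ofReal hp0.le]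
  refine (lintegral_enorm_schwartzConv_rpow_le hp hu.1 K).trans_lt (ENNReal.mul_lt_top ?_ ?_)
  · exact ENNReal.rpow_lt_top_of_nonneg hp0.le K.integrable.2.ne
  · have := hu.2
    rwa [eLpNorm_lt_top_iff_lintegral_rpow_enorm_lt_top h0 ENNReal.ofReal_ne_top,
      ENNReal.toReal_ofReal hp0.le] at this

theorem MeasureTheory.MemLp.integrable_norm_rpow_ofReal {α G : Type*} [MeasurableSpace α]
    [NormedAddCommGroup G] {μ : Measure α} {p : ℝ} (hp : 1 < p) {f : α → G}
    (hf : MemLp f (ENNReal.ofReal p) μ) : Integrable (fun x => ‖f x‖ ^ p) μ := by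
  have hp0 : 0 < p := by linarith
  have := hf.integrable_norm_rpow (by simpa using hp0) ENNReal.ofReal_ne_top
  rwa [ENNReal.toReal_ofReal hp0.le] at this

theorem integral_norm_schwartzConv_rpow_le {p : ℝ} (hp : 1 < p) {u : E → ℝ}
    (hu : MemLp u (ENNReal.ofReal p)) (K : 𝓢(E, F)) :
    ∫ x, ‖schwartzConv K u x‖ ^ p ≤ (∫ x, ‖K x‖) ^ p * ∫ x, ‖u x‖ ^ p := by
  have hp0 : 0 < p := by linarith
  have h := lintegral_enorm_schwartzConv_rpow_le hp hu.1 K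
  have e : ∀ (G : Type) [NormedAddCommGroup G] (f : E → G),
      (∀ x, ‖f x‖ₑ ^ p = ENNReal.ofReal (‖f x‖ ^ p)) := fun G _ f x => by
    rw [← ofReal_norm, ENNReal.ofReal_rpow_of_nonneg (norm_nonneg _) hp0.le]
  simp_rw [e _ (schwartzConv K u), e _ u] at h
  rw [← ofReal_integral_eq_lintegral_ofReal
      ((memLp_schwartzConv hp hu K).integrable_norm_rpow_ofReal hp)
      (Eventually.of_forall fun x => by positivity),
    ← ofReal_integral_eq_lintegral_ofReal (hu.integrable_norm_rpow_ofReal hp)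
      (Eventually.of_forall fun x => by positivity),
    ← ofReal_integral_norm_eq_lintegral_enorm K.integrable,
    ENNReal.ofReal_rpow_of_nonneg (integral_nonneg fun x => norm_nonneg _) hp0.le,
    ← ENNReal.ofReal_mul (by positivity)] at h
  exact (ENNReal.ofReal_le_ofReal_iff (mul_nonneg (Real.rpow_nonneg (integral_nonneg fun x =>
    norm_nonneg _) _) (integral_nonneg fun x => by positivity))).1 h

open LineDeriv in
-- Integration by parts, without boundary terms because a product of an L^p function with a Schwartz
-- function is integrable. The sign it produces cancels the one from differentiating K(x - y) in y.
-- This turns w = div (G * w) into w = ∑ G_j * ∂_j w in the case p < 2.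
theorem schwartzConv_lineDeriv {p : ℝ} (hp : 1 < p) {w : E → ℝ} {v : E}
    (hw : MemLp w (ENNReal.ofReal p)) (hd : Differentiable ℝ w)
    (hw' : MemLp (fun x => fderiv ℝ w x v) (ENNReal.ofReal p)) (K : 𝓢(E, ℝ)) (x : E) :
    schwartzConv (∂_{v} K) w x = schwartzConv K (fun x => fderiv ℝ w x v) x := by
  have hK : ∀ y, HasFDerivAt (fun y => K (x - y)) (-fderiv ℝ K (x - y)) y := fun y => by
    have h := (K.differentiableAt (x := x - y)).hasFDerivAt.comp y ((hasFDerivAt_id y).const_sub x)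
    rwa [ContinuousLinearMap.comp_neg, ContinuousLinearMap.comp_id] at h
  have hKv : ∀ y, fderiv ℝ (fun y => K (x - y)) y v = -(∂_{v} K) (x - y) := fun y => by
    rw [(hK y).fderiv, SchwartzMap.lineDerivOp_apply_eq_fderiv]; rfl
  have h := integral_mul_fderiv_eq_neg_fderiv_mul_of_integrable (μ := (volume : Measure E))
    (f := w) (g := fun y => K (x - y)) (v := v) (integrable_schwartzConv hp hw' K x)
    (by simp_rw [hKv, mul_neg]; exact (integrable_schwartzConv hp hw (∂_{v} K) x).neg)
    (integrable_schwartzConv hp hw K x) (fun y _ => hd y) (fun y _ => (hK y).differentiableAt)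
  simp_rw [hKv, mul_neg, integral_neg, neg_inj] at h
  exact h

/-- Fubini for the pairing of a convolution with a Schwartz function. -/
theorem integrable_prod_schwartzConv {p : ℝ} (hp : 1 < p) {u : E → ℝ}
    (hu : MemLp u (ENNReal.ofReal p)) (K : 𝓢(E, F)) {φ : E → ℝ}
    (hφ : MemLp φ (ENNReal.ofReal p.conjExponent)) :
    Integrable (fun z : E × E => φ z.1 • u z.2 • K (z.1 - z.2)) (volume.prod volume) := by
  have hp0 : 0 < p := by linarith
  have hpq := (Real.HolderConjugate.conjExponent hp).ennrealOfReal
  have hm : AEStronglyMeasurable (fun z : E × E => φ z.1 • u z.2 • K (z.1 - z.2))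
      (volume.prod volume) :=
    hφ.1.comp_fst.smul (hu.1.comp_snd.smul
      (K.continuous.comp (continuous_fst.sub continuous_snd)).aestronglyMeasurable)
  refine ⟨hm, ?_⟩
  rw [HasFiniteIntegral, lintegral_prod _ hm.enorm]
  set h : E → ℝ≥0∞ := fun x => ∫⁻ y, ‖K (x - y)‖ₑ * ‖u y‖ₑ with hh
  have hmh : AEMeasurable h := by
    have : AEMeasurable (fun z : E × E => ‖K (z.1 - z.2)‖ₑ * ‖u z.2‖ₑ) (volume.prod volume) :=
      (K.continuous.comp (continuous_fst.sub continuous_snd)).enorm.measurable.aemeasurable.mul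
        hu.1.comp_snd.enorm
    exact this.lintegral_prod_right'
  have e : ∀ x, ∫⁻ y, ‖φ x • u y • K (x - y)‖ₑ = ‖φ x‖ₑ * h x := fun x => by
    rw [hh, ← lintegral_const_mul' _ _ enorm_ne_top]
    refine lintegral_congr fun y => ?_
    rw [enorm_smul, enorm_smul, mul_comm ‖u y‖ₑ]
  simp_rw [e]
  have hH := ENNReal.lintegral_mul_le_Lp_mul_Lq volume (Real.HolderConjugate.conjExponent hp).symm
    hφ.1.enorm hmh
  refine lt_of_le_of_lt hH (ENNReal.mul_lt_top ?_ ?_)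
  · have hq0 := (Real.HolderConjugate.conjExponent hp).symm.pos
    refine ENNReal.rpow_lt_top_of_nonneg (by positivity) (ne_of_lt ?_)
    have := hφ.2
    rwa [eLpNorm_lt_top_iff_lintegral_rpow_enorm_lt_top (by simpa using hq0) ENNReal.ofReal_ne_top,
      ENNReal.toReal_ofReal hq0.le] at this
  · refine ENNReal.rpow_lt_top_of_nonneg (by positivity) (ne_of_lt ?_)
    refine (lintegral_convolution_rpow_le hp (f := fun x => ‖K x‖ₑ) (g := fun x => ‖u x‖ₑ)
      K.continuous.enorm.measurable hu.1.enorm).trans_lt (ENNReal.mul_lt_top ?_ ?_)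
    · exact ENNReal.rpow_lt_top_of_nonneg hp0.le K.integrable.2.ne
    · have := hu.2
      rwa [eLpNorm_lt_top_iff_lintegral_rpow_enorm_lt_top (by simpa using hp0)
        ENNReal.ofReal_ne_top, ENNReal.toReal_ofReal hp0.le] at this

end SchwartzConvolution

/-! ### Fourier support and reproduction by convolution. -/

section Representation

open LineDeriv

/-- `𝓕 (m · 𝓕⁻ φ)` is the correlation of `φ` with `𝓕⁻ m`. -/
theorem fourier_pairing_fourierInv {E : Type} [NormedAddCommGroup E] [InnerProductSpace ℝ E]
    [FiniteDimensional ℝ E] [MeasurableSpace E] [BorelSpace E] (m φ : 𝓢(E, ℂ)) (x : E) :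
    𝓕 (SchwartzMap.pairing (ContinuousLinearMap.mul ℂ ℂ) m (𝓕⁻ φ)) x
      = ∫ y, φ y * (𝓕⁻ m) (y - x) := by
  have h1 : SchwartzMap.pairing (ContinuousLinearMap.mul ℂ ℂ) m (𝓕⁻ φ)
      = 𝓕 (SchwartzMap.convolution (ContinuousLinearMap.mul ℂ ℂ) (𝓕⁻ m) (𝓕⁻ (𝓕⁻ φ))) := by
    rw [SchwartzMap.fourier_convolution, FourierTransform.fourier_fourierInv_eq,
      FourierTransform.fourier_fourierInv_eq]
  have h2 : ∀ f : 𝓢(E, ℂ), ∀ z, 𝓕 f z = 𝓕⁻ f (-z) := fun f z => by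
    rw [SchwartzMap.fourierInv_apply_eq]; simp
  have h3 : ∀ z, (𝓕⁻ (𝓕⁻ φ)) z = φ (-z) := fun z => by
    have := h2 (𝓕⁻ φ) (-z)
    rw [FourierTransform.fourier_fourierInv_eq, neg_neg] at this
    exact this.symm
  rw [h1, h2, FourierTransform.fourierInv_fourier_eq, SchwartzMap.convolution_apply, convolution]
  simp only [ContinuousLinearMap.mul_apply', h3]
  rw [← integral_sub_right_eq_self _ x]
  refine integral_congr_ae (Eventually.of_forall fun y => ?_)
  simp only
  rw [mul_comm]
  congr 2
  abel

/-- For a test function φ, (1 - m)𝓕⁻φ has its support away from that of the Fourier transform of u,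
which therefore annihilates it. So u takes the same value on φ and on 𝓕(m 𝓕⁻φ); the latter is a
correlation of φ with 𝓕⁻m, and Fubini moves the kernel onto u. -/
theorem ae_eq_schwartzConv_of_fourierSupport {N : ℕ} {p : ℝ} (hp : 1 < p)
    {u : EuclideanSpace ℝ (Fin N) → ℝ} (hu : MemLp u (ENNReal.ofReal p) volume)
    (m : 𝓢(EuclideanSpace ℝ (Fin N), ℂ))
    (hm : Disjoint (closure {η | m η ≠ 1}) (fourierSupport (lpDistribution hp u hu))) :
    (fun x => (u x : ℂ)) =ᵐ[volume] schwartzConv (𝓕⁻ m) u := by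
  have h1p : (1 : ℝ≥0∞) ≤ ENNReal.ofReal p := by simpa using hp.le
  refine ae_eq_of_integral_contDiff_smul_eq (hu.ofReal.locallyIntegrable h1p)
    ((contDiff_schwartzConv hp hu _).continuous.locallyIntegrable) fun g hg hgc => ?_
  have hφc : HasCompactSupport (fun x => (g x : ℂ)) := hgc.comp_left (g := Complex.ofReal) rfl
  set φ : 𝓢(EuclideanSpace ℝ (Fin N), ℂ) :=
    hφc.toSchwartzMap (Complex.ofRealCLM.contDiff.comp hg) with hφ
  have hφg : ∀ x, φ x = g x := fun x => rfl
  set S := lpDistribution hp u hu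
  set P := SchwartzMap.pairing (ContinuousLinearMap.mul ℂ ℂ) m (𝓕⁻ φ) with hP
  have hz : (𝓕 S : 𝓢'(EuclideanSpace ℝ (Fin N), ℂ)) (𝓕⁻ φ - P) = 0 := by
    refine tempered_apply_eq_zero _ _ (Disjoint.mono_left (closure_mono fun η hη => ?_) hm)
    refine fun h : m η = 1 => hη ?_
    simp [hP, SchwartzMap.pairing_apply_apply, h]
  have hS : S φ = S (𝓕 P) := by
    rw [map_sub, sub_eq_zero, TemperedDistribution.fourier_apply,
      FourierTransform.fourier_fourierInv_eq, TemperedDistribution.fourier_apply] at hz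
    exact hz
  rw [lpDistribution_apply, lpDistribution_apply] at hS
  have hint := integrable_prod_schwartzConv hp hu (𝓕⁻ m)
    (hg.continuous.memLp_of_hasCompactSupport (μ := volume)
      (p := ENNReal.ofReal p.conjExponent) hgc)
  calc ∫ x, g x • (u x : ℂ) = ∫ x, φ x * (u x : ℂ) := by simp [hφg]
    _ = ∫ x, 𝓕 P x * (u x : ℂ) := hS
    _ = ∫ x, ∫ y, g y • u x • (𝓕⁻ m) (y - x) := by
        refine integral_congr_ae (Eventually.of_forall fun x => ?_)
        simp only
        rw [hP, fourier_pairing_fourierInv, ← integral_mul_const]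
        refine integral_congr_ae (Eventually.of_forall fun y => ?_)
        simp only [hφg, Complex.real_smul]
        ring
    _ = ∫ y, ∫ x, g y • u x • (𝓕⁻ m) (y - x) := (integral_integral_swap hint).symm
    _ = ∫ y, g y • schwartzConv (𝓕⁻ m) u y := by
        refine integral_congr_ae (Eventually.of_forall fun y => ?_)
        exact integral_smul _ _

/-! ### Dilations, the annulus cutoff and the reproducing kernel. -/

/-- The dilation `x ↦ R x` as a continuous linear equivalence. -/
noncomputable def dilation (E : Type) [NormedAddCommGroup E] [InnerProductSpace ℝ E]
    [FiniteDimensional ℝ E] {R : ℝ} (hR : R ≠ 0) : E ≃L[ℝ] E :=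
  (LinearEquiv.smulOfNeZero ℝ E R hR).toContinuousLinearEquiv

section Dilation

variable {E : Type} [NormedAddCommGroup E] [InnerProductSpace ℝ E] [FiniteDimensional ℝ E]

@[simp] theorem dilation_apply {R : ℝ} (hR : R ≠ 0) (x : E) : dilation E hR x = R • x := rfl

theorem lineDerivOp_dilation {F : Type} [NormedAddCommGroup F] [NormedSpace ℝ F] {R : ℝ}
    (hR : R ≠ 0) (v : E) (f : 𝓢(E, F)) :
    ∂_{v} (SchwartzMap.compCLMOfContinuousLinearEquiv ℝ (dilation E hR) f)
      = R • SchwartzMap.compCLMOfContinuousLinearEquiv ℝ (dilation E hR) (∂_{v} f) := by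
  rw [SchwartzMap.lineDerivOp_compCLMOfContinuousLinearEquiv, dilation_apply,
    lineDerivOp_left_smul, map_smul]

variable [MeasurableSpace E] [BorelSpace E]

theorem fourierInv_dilation {R : ℝ} (hR : 0 < R) (f : 𝓢(E, ℂ)) (x : E) :
    𝓕⁻ (SchwartzMap.compCLMOfContinuousLinearEquiv ℝ (dilation E (inv_ne_zero hR.ne')) f) x
      = R ^ Module.finrank ℝ E • 𝓕⁻ f (R • x) := by
  rw [SchwartzMap.fourierInv_coe, SchwartzMap.fourierInv_coe, Real.fourierInv_eq,
    Real.fourierInv_eq]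
  rw [← Measure.integral_comp_inv_smul_of_nonneg volume _ hR.le]
  refine integral_congr_ae (Eventually.of_forall fun v => ?_)
  simp only [SchwartzMap.compCLMOfContinuousLinearEquiv_apply, Function.comp_apply, dilation_apply]
  rw [real_inner_smul_left, real_inner_smul_right, inv_mul_cancel_left₀ hR.ne']

end Dilation

theorem lineDerivOp_postcompCLM {E F G : Type} [NormedAddCommGroup E] [NormedSpace ℝ E]
    [NormedAddCommGroup F] [NormedSpace ℝ F] [NormedAddCommGroup G] [NormedSpace ℝ G]
    (L : F →L[ℝ] G) (v : E) (f : 𝓢(E, F)) :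
    ∂_{v} (SchwartzMap.postcompCLM L f) = SchwartzMap.postcompCLM L (∂_{v} f) := by
  ext x
  rw [SchwartzMap.lineDerivOp_apply_eq_fderiv, SchwartzMap.postcompCLM_apply,
    SchwartzMap.lineDerivOp_apply_eq_fderiv]
  have h := (L.hasFDerivAt (x := f x)).comp x (f.hasFDerivAt x)
  have h' : (⇑(SchwartzMap.postcompCLM L f)) = L ∘ f := rfl
  rw [h', h.fderiv]; rfl

/-- A Fourier cutoff to an annulus, together with its division by `-4π²‖η‖²`. -/
theorem exists_annulus_cutoff {E : Type} [NormedAddCommGroup E] [InnerProductSpace ℝ E]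
    [FiniteDimensional ℝ E] {r s : ℝ} (hr : 0 < r) (hs : 0 < s) :
    ∃ m b : 𝓢(E, ℂ), (∀ η, r ≤ ‖η‖ → ‖η‖ ≤ s → m η = 1) ∧
      ∀ η, m η = ((-(2 * Real.pi) ^ 2 * ‖η‖ ^ 2 : ℝ) : ℂ) * b η := by
  obtain ⟨χ₀, h1, h2⟩ : ∃ χ : ContDiffBump (0 : E), χ.rIn = r / 2 ∧ χ.rOut = r :=
    ⟨⟨r / 2, r, by positivity, by linarith⟩, rfl, rfl⟩
  obtain ⟨χ₁, h3, h4⟩ : ∃ χ : ContDiffBump (0 : E), χ.rIn = s ∧ χ.rOut = s + 1 :=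
    ⟨⟨s, s + 1, hs, by linarith⟩, rfl, rfl⟩
  set m : E → ℂ := fun η => ((χ₁ η * (1 - χ₀ η) : ℝ) : ℂ) with hm
  set b : E → ℂ := fun η => (((-(2 * Real.pi) ^ 2 * ‖η‖ ^ 2)⁻¹ * (χ₁ η * (1 - χ₀ η)) : ℝ) : ℂ)
    with hb
  have hmr : ContDiff ℝ ∞ (fun η => χ₁ η * (1 - χ₀ η)) :=
    χ₁.contDiff.mul (contDiff_const.sub χ₀.contDiff)
  have hms : ContDiff ℝ ∞ m := Complex.ofRealCLM.contDiff.comp hmr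
  have hz : ∀ η : E, ‖η‖ < r / 2 → χ₀ η = 1 := fun η hη =>
    χ₀.one_of_mem_closedBall (by rw [h1]; simpa using hη.le)
  -- The quotient is smooth at the origin because the cutoff vanishes identically on a ball around
  -- it.
  have hbs : ContDiff ℝ ∞ b := by
    refine Complex.ofRealCLM.contDiff.comp (contDiff_iff_contDiffAt.2 fun η => ?_)
    by_cases hη : η = 0
    · have : (fun η => (-(2 * Real.pi) ^ 2 * ‖η‖ ^ 2)⁻¹ * (χ₁ η * (1 - χ₀ η)))
          =ᶠ[𝓝 η] fun _ => 0 := by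
        have : ∀ᶠ y in 𝓝 η, ‖y‖ < r / 2 :=
          continuous_norm.continuousAt.eventually (gt_mem_nhds (by rw [hη]; simpa using hr))
        filter_upwards [this] with y hy
        rw [hz y hy]; simp
      exact contDiffAt_const.congr_of_eventuallyEq this
    · refine ContDiffAt.mul (ContDiffAt.inv ?_ ?_) hmr.contDiffAt
      · exact contDiffAt_const.mul (contDiff_norm_sq ℝ).contDiffAt
      · have := norm_pos_iff.2 hη
        have := Real.pi_pos
        have : 0 < (2 * Real.pi) ^ 2 * ‖η‖ ^ 2 := by positivity
        linarith
  have hmc : HasCompactSupport m := (χ₁.hasCompactSupport.mul_right).comp_left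
    (g := Complex.ofReal) rfl
  have hbc : HasCompactSupport b := ((χ₁.hasCompactSupport.mul_right).mul_left).comp_left
    (g := Complex.ofReal) rfl
  refine ⟨hmc.toSchwartzMap hms, hbc.toSchwartzMap hbs, fun η hη1 hη2 => ?_, fun η => ?_⟩
  · change m η = 1
    rw [hm]
    simp only
    rw [χ₀.zero_of_le_dist (by rw [h2]; simpa using hη1),
      χ₁.one_of_mem_closedBall (by rw [h3]; simpa using hη2)]
    simp
  · change m η = _ * b η
    rw [hm, hb]
    simp only
    rw [← Complex.ofReal_mul]
    congr 1
    by_cases hη : η = 0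
    · rw [hz η (by rw [hη]; simpa using hr)]; simp
    · have h1 := norm_pos_iff.2 hη
      have h2 := Real.pi_pos
      have : (2 * Real.pi) ^ 2 * ‖η‖ ^ 2 ≠ 0 := by positivity
      rw [← mul_assoc, mul_inv_cancel₀, one_mul]
      rw [neg_mul]
      exact neg_ne_zero.2 this

/-- The standard basis vector of `ℝ^N`. -/
noncomputable def stdVec {N : ℕ} (j : Fin N) : EuclideanSpace ℝ (Fin N) :=
  EuclideanSpace.single j 1

theorem stdVec_def {N : ℕ} (j : Fin N) :
    (stdVec j : EuclideanSpace ℝ (Fin N)) = EuclideanSpace.single j 1 := rfl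

/-- Functions with Fourier support in the annulus of radii `R`, `κ R` are reproduced by convolution
with the Laplacian of a kernel whose gradient has `L¹` norm of order `R⁻¹`. -/
theorem exists_reproducing_kernel (N : ℕ) {κ : ℝ} (hκ : 1 < κ) :
    ∃ C : ℝ, 0 < C ∧ ∀ R : ℝ, 0 < R → ∃ G : Fin N → 𝓢(EuclideanSpace ℝ (Fin N), ℝ),
      (∀ j, ∫ x, ‖G j x‖ ≤ C / R) ∧
      ∀ (p : ℝ) (hp : 1 < p) (u : EuclideanSpace ℝ (Fin N) → ℝ)
        (hu : MemLp u (ENNReal.ofReal p) volume),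
        fourierSupport (lpDistribution hp u hu) ⊆ frequencyAnnulus N R (κ * R) →
        u =ᵐ[volume] schwartzConv (∑ j : Fin N, ∂_{stdVec j} (G j)) u := by
  have hπ := Real.pi_pos
  have hπ3 := Real.pi_gt_three
  -- At scale 1 the annulus is 1/(2π) ≤ ‖η‖ ≤ κ/(2π). The radii 1/(4π) and κ leave room on both
  -- sides, so that the closure of {m ≠ 1} misses it.
  obtain ⟨m, b, hm1, hmb⟩ := exists_annulus_cutoff (E := EuclideanSpace ℝ (Fin N)) (r := 1 / (4 * Real.pi)) (s := κ)
    (by positivity) (by linarith)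
  -- As u is real, the real part of the kernel reproduces it too.
  obtain ⟨g, hg⟩ : ∃ g : 𝓢(EuclideanSpace ℝ (Fin N), ℝ), g = SchwartzMap.postcompCLM Complex.reCLM (𝓕⁻ b) := ⟨_, rfl⟩
  have hlap : ∑ j : Fin N, ∂_{stdVec j} (∂_{stdVec j} g) = SchwartzMap.postcompCLM Complex.reCLM (𝓕⁻ m) := by
    have h1 : ∑ j : Fin N, ∂_{stdVec j} (∂_{stdVec j} (𝓕⁻ b)) = 𝓕⁻ m := by
      have h := SchwartzMap.laplacian_eq_sum (EuclideanSpace.basisFun (Fin N) ℝ) (𝓕⁻ b)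
      simp only [EuclideanSpace.basisFun_apply, ← stdVec_def] at h
      rw [← h, SchwartzMap.laplacian_eq_fourierMultiplierCLM,
        SchwartzMap.fourierMultiplierCLM_apply, FourierTransform.fourier_fourierInv_eq,
        ← FourierTransform.fourierInv_smul]
      congr 1
      ext η
      rw [hmb, FunLike.coe_smul, Pi.smul_apply, SchwartzMap.smulLeftCLM_apply_apply (by fun_prop)]
      simp
      ring
    rw [← h1, map_sum]
    simp only [hg, lineDerivOp_postcompCLM]
  -- The summand 1 only secures positivity.
  refine ⟨1 + ∑ j : Fin N, ∫ x, ‖(∂_{stdVec j} g) x‖,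
    add_pos_of_pos_of_nonneg one_pos (Finset.sum_nonneg fun j _ => integral_nonneg fun x =>
      norm_nonneg _), fun R hR => ?_⟩
  set D : 𝓢(EuclideanSpace ℝ (Fin N), ℝ) →L[ℝ] 𝓢(EuclideanSpace ℝ (Fin N), ℝ) :=
    SchwartzMap.compCLMOfContinuousLinearEquiv ℝ (dilation (EuclideanSpace ℝ (Fin N)) hR.ne') with hD
  have hfr : Module.finrank ℝ (EuclideanSpace ℝ (Fin N)) = N := by simp
  -- The rescaled potential is R^(N-2) g(Rx): its Laplacian is R^N (Δg)(Rx), the kernel of the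
  -- dilated cutoff, and its gradient has L¹ norm of order 1/R. The quotient form avoids truncated
  -- subtraction when N = 1.
  set a : ℝ := R ^ N / R ^ 2 with ha
  have hd1 : ∀ j : Fin N, ∂_{stdVec j} (a • D g) = (a * R) • D (∂_{stdVec j} g) := fun j => by
    rw [lineDerivOp_smul, lineDerivOp_dilation, smul_smul]
  refine ⟨fun j => ∂_{stdVec j} (a • D g), fun j => ?_, fun p hp u hu hsupp => ?_⟩
  · simp only [hd1]
    have h1 : ∀ x, ‖((a * R) • D (∂_{stdVec j} g)) x‖ = (a * R) * ‖(∂_{stdVec j} g) (R • x)‖ := fun x => by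
      change ‖(a * R) • (∂_{stdVec j} g) (R • x)‖ = _
      rw [norm_smul, Real.norm_of_nonneg (by positivity)]
    simp_rw [h1]
    set f : 𝓢(EuclideanSpace ℝ (Fin N), ℝ) := ∂_{stdVec j} g with hf
    rw [integral_const_mul, Measure.integral_comp_smul_of_nonneg volume
      (fun x => ‖f x‖) R (hR := hR.le), hfr, smul_eq_mul, ← mul_assoc]
    have h2 : a * R * (R ^ N)⁻¹ = 1 / R := by rw [ha]; field_simp
    rw [h2, div_mul_eq_mul_div, one_mul]
    gcongr
    have := Finset.single_le_sum (f := fun j => ∫ x, ‖(∂_{stdVec j} g) x‖)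
      (fun j _ => integral_nonneg fun x => norm_nonneg _) (Finset.mem_univ j)
    linarith
  · set mR : 𝓢(EuclideanSpace ℝ (Fin N), ℂ) :=
      SchwartzMap.compCLMOfContinuousLinearEquiv ℝ (dilation (EuclideanSpace ℝ (Fin N)) (inv_ne_zero hR.ne')) m with hmR
    have hK : ∑ j : Fin N, ∂_{stdVec j} (∂_{stdVec j} (a • D g)) = SchwartzMap.postcompCLM Complex.reCLM (𝓕⁻ mR) := by
      have h1 : ∀ j : Fin N, ∂_{stdVec j} (∂_{stdVec j} (a • D g)) = (R ^ N) • D (∂_{stdVec j} (∂_{stdVec j} g)) := fun j => by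
        rw [hd1, lineDerivOp_smul, lineDerivOp_dilation, smul_smul]
        congr 1
        rw [ha]; field_simp
      simp_rw [h1]
      rw [← Finset.smul_sum, ← map_sum, hlap]
      ext x
      rw [SchwartzMap.postcompCLM_apply, hmR, fourierInv_dilation hR, hfr]
      change R ^ N • ((𝓕⁻ m) (R • x)).re = _
      exact (Complex.reCLM.map_smul _ _).symm
    have hdisj : Disjoint (closure {η | mR η ≠ 1}) (fourierSupport (lpDistribution hp u hu)) := by
      refine Disjoint.mono_right hsupp ?_
      have hcl : IsClosed {η : EuclideanSpace ℝ (Fin N) | ‖η‖ ≤ R * (1 / (4 * Real.pi)) ∨ R * κ ≤ ‖η‖} :=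
        (isClosed_le continuous_norm continuous_const).union
          (isClosed_le continuous_const continuous_norm)
      have hsub : closure {η | mR η ≠ 1} ⊆
          {η : EuclideanSpace ℝ (Fin N) | ‖η‖ ≤ R * (1 / (4 * Real.pi)) ∨ R * κ ≤ ‖η‖} := by
        refine closure_minimal (fun η hη => ?_) hcl
        by_contra hcon
        simp only [Set.mem_ofPred_eq, not_or, not_le] at hcon
        refine hη ?_
        change m (R⁻¹ • η) = 1
        have hn : ‖R⁻¹ • η‖ = ‖η‖ / R := by
          rw [norm_smul, Real.norm_of_nonneg (by positivity), inv_mul_eq_div]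
        refine hm1 _ ?_ ?_
        · rw [hn, le_div_iff₀ hR]; linarith [hcon.1]
        · rw [hn, div_le_iff₀ hR]; linarith [hcon.2]
      refine Disjoint.mono_left hsub (Set.disjoint_left.2 ?_)
      rintro η h1 ⟨h2, h3⟩
      have h4 : 0 < R * κ := by positivity
      rcases h1 with h1 | h1
      · have h5 : 2 * Real.pi * ‖η‖ ≤ 2 * Real.pi * (R * (1 / (4 * Real.pi))) := by gcongr
        have h6 : 2 * Real.pi * (R * (1 / (4 * Real.pi))) = R / 2 := by field_simp; norm_num
        linarith
      · have h5 : 2 * Real.pi * (R * κ) ≤ 2 * Real.pi * ‖η‖ := by gcongr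
        nlinarith
    have hrep := ae_eq_schwartzConv_of_fourierSupport hp hu mR hdisj
    change u =ᵐ[volume] schwartzConv (∑ j : Fin N, ∂_{stdVec j} (∂_{stdVec j} (a • D g))) u
    rw [hK]
    filter_upwards [hrep] with x hx
    have h1 : u x = (schwartzConv (𝓕⁻ mR) u x).re := by rw [← hx]; simp
    rw [h1]
    change Complex.reCLM _ = _
    rw [schwartzConv, ← ContinuousLinearMap.integral_comp_comm _ (integrable_schwartzConv hp hu _ x)]
    refine integral_congr_ae (Eventually.of_forall fun y => ?_)
    simp

end Representation

/-! ### Smooth truncations of the power nonlinearity. -/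

section PowerTruncation

theorem hasDerivAt_abs_rpow_sub_two_mul (p : ℝ) {s : ℝ} (hs : s ≠ 0) :
    HasDerivAt (fun s => |s| ^ (p - 2) * s) ((p - 1) * |s| ^ (p - 2)) s := by
  have h0 : 0 < |s| := abs_pos.2 hs
  have h := ((hasDerivAt_abs hs).rpow_const (p := p - 2) (Or.inl h0.ne')).mul (hasDerivAt_id s)
  refine h.congr_deriv ?_
  have e : |s| ^ (p - 2) = |s| ^ (p - 2 - 1) * |s| := by
    rw [← Real.rpow_add_one h0.ne']; congr 1; ring
  have e2 : (SignType.sign s : ℝ) * s = |s| := sign_mul_self s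
  simp only [id, mul_one]
  rw [e]
  linear_combination ((p - 2) * |s| ^ (p - 2 - 1)) * e2

theorem abs_abs_rpow_sub_two_mul {p : ℝ} (hp : 1 < p) (s : ℝ) :
    |(|s| ^ (p - 2) * s)| = |s| ^ (p - 1) := by
  rcases eq_or_ne s 0 with rfl | hs
  · simp [Real.zero_rpow (show p - 1 ≠ 0 by linarith)]
  · have h0 : 0 < |s| := abs_pos.2 hs
    rw [abs_mul, abs_of_nonneg (by positivity), ← Real.rpow_add_one h0.ne']
    congr 1; ring

/-- A monotone transition composed with t² - 1 increases with |t|, whence t θ'(t) ≥ 0. The quantity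
t θ'(t) is the one that enters the derivative of the dilates θ(mt) without a factor m, so its bound
B serves all truncations at once. -/
theorem exists_smooth_cutoff_away_from_zero :
    ∃ (θ : ℝ → ℝ) (B : ℝ), 0 ≤ B ∧ ContDiff ℝ ∞ θ ∧ (∀ t, 0 ≤ θ t ∧ θ t ≤ 1) ∧
      (∀ t, |t| < 1 → θ t = 0) ∧ (∀ t, 2 ≤ |t| → θ t = 1) ∧
      (∀ t, 0 ≤ t * deriv θ t ∧ t * deriv θ t ≤ B) ∧ (∀ t, 2 < |t| → deriv θ t = 0) := by
  set θ : ℝ → ℝ := fun t => Real.smoothTransition (t ^ 2 - 1) with hθ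
  have hs : ContDiff ℝ ∞ θ := by
    have : ContDiff ℝ ∞ Real.smoothTransition := Real.smoothTransition.contDiff
    exact this.comp ((contDiff_id.pow 2).sub contDiff_const)
  have h1 : ∀ t, 2 ≤ |t| → θ t = 1 := fun t ht => by
    refine Real.smoothTransition.one_of_one_le ?_
    rw [← sq_abs]; nlinarith
  have hd : ∀ t, deriv θ t = deriv Real.smoothTransition (t ^ 2 - 1) * (2 * t) := fun t => by
    have hT : DifferentiableAt ℝ Real.smoothTransition (t ^ 2 - 1) :=
      (Real.smoothTransition.contDiff (n := 1)).differentiable (by simp) _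
    have h := hT.hasDerivAt.comp t (((hasDerivAt_id t).pow 2).sub_const 1)
    rw [show θ = Real.smoothTransition ∘ fun t => t ^ 2 - 1 from rfl]
    exact h.deriv.trans (by simp)
  have hz : ∀ t, 2 < |t| → deriv θ t = 0 := fun t ht => by
    have : θ =ᶠ[𝓝 t] fun _ => 1 := by
      filter_upwards [continuous_abs.continuousAt.eventually (lt_mem_nhds ht)] with s hs
      exact h1 s hs.le
    rw [this.deriv_eq]; simp
  have hcont : Continuous fun t => t * deriv θ t :=
    continuous_id.mul (hs.continuous_deriv (by simp))
  have hcs : HasCompactSupport fun t => t * deriv θ t := by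
    refine HasCompactSupport.intro (isCompact_Icc (a := (-2 : ℝ)) (b := 2)) fun t ht => ?_
    rw [hz t, mul_zero]
    by_contra hcon
    exact ht (abs_le.1 (not_lt.1 hcon))
  obtain ⟨B, hB⟩ := hcont.bounded_above_of_compact_support hcs
  refine ⟨θ, B, (norm_nonneg _).trans (hB 0), hs,
    fun t => ⟨Real.smoothTransition.nonneg _, Real.smoothTransition.le_one _⟩, fun t ht => ?_, h1,
    fun t => ⟨?_, (le_abs_self _).trans (hB t)⟩, hz⟩
  · refine Real.smoothTransition.zero_of_nonpos ?_
    rw [← sq_abs]; nlinarith [abs_nonneg t]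
  · rw [hd]
    have := Real.smoothTransition.monotone.deriv_nonneg (x := t ^ 2 - 1)
    nlinarith [mul_nonneg this (sq_nonneg t)]

/-- Smooth approximations of `s ↦ |s|^(p-2) s` that vanish near `0`. -/
theorem exists_smooth_power_truncation {p : ℝ} (hp : 1 < p) :
    ∃ (ψ : ℕ → ℝ → ℝ) (C : ℝ), 0 ≤ C ∧ (∀ n, ContDiff ℝ ∞ (ψ n)) ∧ (∀ n, ψ n 0 = 0) ∧
      (∀ n, deriv (ψ n) 0 = 0) ∧
      (∀ n s, |ψ n s| ≤ |s| ^ (p - 1)) ∧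
      (∀ n s, 0 ≤ deriv (ψ n) s ∧ deriv (ψ n) s ≤ C * |s| ^ (p - 2)) ∧
      (∀ s, Tendsto (fun n => ψ n s) atTop (𝓝 (|s| ^ (p - 2) * s))) ∧
      (∀ s, s ≠ 0 → Tendsto (fun n => deriv (ψ n) s) atTop (𝓝 ((p - 1) * |s| ^ (p - 2)))) := by
  obtain ⟨θ, B, hB0, hθs, hθ01, hθ0, hθ1, hθd, hθz⟩ := exists_smooth_cutoff_away_from_zero
  set m : ℕ → ℝ := fun n => (n : ℝ) + 1 with hm
  have hmpos : ∀ n, 0 < m n := fun n => by positivity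
  set ψ : ℕ → ℝ → ℝ := fun n s => (|s| ^ (p - 2) * s) * θ (m n * s) with hψ
  have hloc : ∀ n, ψ n =ᶠ[𝓝 0] fun _ => 0 := fun n => by
    have : ∀ᶠ s : ℝ in 𝓝 0, |m n * s| < 1 := by
      have hc : Continuous fun s : ℝ => |m n * s| := by fun_prop
      exact hc.continuousAt.eventually (gt_mem_nhds (by simp))
    filter_upwards [this] with s hs
    simp [hψ, hθ0 _ hs]
  have hθm : ∀ n s, HasDerivAt (fun s => θ (m n * s)) (deriv θ (m n * s) * m n) s := fun n s => by
    have hT : DifferentiableAt ℝ θ (m n * s) := hθs.differentiable (by simp) _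
    exact hT.hasDerivAt.comp s ((hasDerivAt_id s).const_mul (m n) |>.congr_deriv (mul_one _))
  -- With t = m n * s the bracket is (p-1)θ(t) + tθ'(t), which lies between 0 and p - 1 + B for
  -- every n.
  have hdne : ∀ n s, s ≠ 0 → deriv (ψ n) s
      = |s| ^ (p - 2) * ((p - 1) * θ (m n * s) + m n * s * deriv θ (m n * s)) := fun n s hs => by
    refine ((hasDerivAt_abs_rpow_sub_two_mul p hs).mul (hθm n s)).deriv.trans ?_
    ring
  have hd0 : ∀ n, deriv (ψ n) 0 = 0 := fun n => by rw [(hloc n).deriv_eq]; simp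
  have hlarge : ∀ s : ℝ, s ≠ 0 → ∀ᶠ n in atTop, 2 < |m n * s| := fun s hs => by
    have h0 : 0 < |s| := abs_pos.2 hs
    have : Tendsto (fun n => m n * |s|) atTop atTop :=
      (tendsto_atTop_add_const_right _ _ tendsto_natCast_atTop_atTop).atTop_mul_const h0
    filter_upwards [this.eventually_gt_atTop 2] with n hn
    rwa [abs_mul, abs_of_pos (hmpos n)]
  refine ⟨ψ, (p - 1) + B, by linarith, fun n => ?_, fun n => (hloc n).self_of_nhds, hd0,
    fun n s => ?_, fun n s => ?_, fun s => ?_, fun s hs => ?_⟩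
  · refine contDiff_iff_contDiffAt.2 fun s => ?_
    by_cases hs : s = 0
    · rw [hs]; exact contDiffAt_const.congr_of_eventuallyEq (hloc n)
    · refine ContDiffAt.mul (ContDiffAt.mul ?_ contDiffAt_id)
        (hθs.comp (contDiff_const.mul contDiff_id)).contDiffAt
      exact (contDiffAt_abs hs).rpow_const_of_ne (abs_pos.2 hs).ne'
  · rw [hψ]
    simp only
    rw [abs_mul, abs_abs_rpow_sub_two_mul hp, abs_of_nonneg (hθ01 _).1]
    exact mul_le_of_le_one_right (by positivity) (hθ01 _).2
  · by_cases hs : s = 0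
    · rw [hs, hd0]
      exact ⟨le_rfl, mul_nonneg (by linarith) (by positivity)⟩
    · rw [hdne n s hs, mul_comm (p - 1 + B)]
      have h1 := hθ01 (m n * s)
      have h2 := hθd (m n * s)
      have hp1 : 0 ≤ p - 1 := by linarith
      refine ⟨mul_nonneg (by positivity) (add_nonneg (mul_nonneg hp1 h1.1) h2.1), ?_⟩
      gcongr
      · exact mul_le_of_le_one_right hp1 h1.2
      · exact h2.2
  · by_cases hs : s = 0
    · rw [hs]; simp [hψ]
    · refine tendsto_const_nhds.congr' ?_
      filter_upwards [hlarge s hs] with n hn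
      simp [hψ, hθ1 _ hn.le]
  · refine tendsto_const_nhds.congr' ?_
    filter_upwards [hlarge s hs] with n hn
    rw [hdne n s hs, hθ1 _ hn.le, hθz _ hn]
    ring

end PowerTruncation

/-! ### Partial derivatives, zero sets and test functions approximating the power. -/

section PartialDeriv

variable {N : ℕ}

/-- The `j`-th partial derivative. -/
noncomputable def pd (j : Fin N) (f : EuclideanSpace ℝ (Fin N) → ℝ)
    (x : EuclideanSpace ℝ (Fin N)) : ℝ := fderiv ℝ f x (stdVec j)

theorem gradient_apply_eq_pd {f : EuclideanSpace ℝ (Fin N) → ℝ} (x : EuclideanSpace ℝ (Fin N))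
    (j : Fin N) : (∇ f x) j = pd j f x := by
  rw [pd, ← InnerProductSpace.toDual_symm_apply, ← gradient, real_inner_comm, stdVec,
    EuclideanSpace.inner_single_left]
  simp

theorem inner_gradient_eq_sum (f g : EuclideanSpace ℝ (Fin N) → ℝ)
    (x : EuclideanSpace ℝ (Fin N)) :
    inner ℝ (∇ f x) (∇ g x) = ∑ j, pd j f x * pd j g x := by
  simp only [PiLp.inner_apply, gradient_apply_eq_pd]
  exact Finset.sum_congr rfl fun j _ => by simp [mul_comm]

theorem norm_gradient_sq (f : EuclideanSpace ℝ (Fin N) → ℝ) (x : EuclideanSpace ℝ (Fin N)) :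
    ‖∇ f x‖ ^ 2 = ∑ j, pd j f x ^ 2 := by
  rw [← real_inner_self_eq_norm_sq, inner_gradient_eq_sum]
  exact Finset.sum_congr rfl fun j _ => (sq _).symm

theorem abs_pd_le_norm_gradient (f : EuclideanSpace ℝ (Fin N) → ℝ)
    (x : EuclideanSpace ℝ (Fin N)) (j : Fin N) : |pd j f x| ≤ ‖∇ f x‖ := by
  refine abs_le_of_sq_le_sq ?_ (norm_nonneg _)
  rw [norm_gradient_sq]
  exact Finset.single_le_sum (f := fun j => pd j f x ^ 2) (fun j _ => sq_nonneg _)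
    (Finset.mem_univ j)

theorem contDiff_pd {f : EuclideanSpace ℝ (Fin N) → ℝ} (hf : ContDiff ℝ ∞ f) (j : Fin N) :
    ContDiff ℝ ∞ (pd j f) :=
  (hf.fderiv_right (m := ∞) (by simp)).clm_apply contDiff_const

theorem pd_mul {f g : EuclideanSpace ℝ (Fin N) → ℝ} {x : EuclideanSpace ℝ (Fin N)}
    (hf : DifferentiableAt ℝ f x) (hg : DifferentiableAt ℝ g x) (j : Fin N) :
    pd j (fun x => f x * g x) x = f x * pd j g x + g x * pd j f x := by
  rw [pd, fderiv_fun_mul hf hg]; rfl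

theorem pd_comp {f : EuclideanSpace ℝ (Fin N) → ℝ} {h : ℝ → ℝ} {x : EuclideanSpace ℝ (Fin N)}
    (hh : DifferentiableAt ℝ h (f x)) (hf : DifferentiableAt ℝ f x) (j : Fin N) :
    pd j (fun x => h (f x)) x = deriv h (f x) * pd j f x := by
  have := hh.hasDerivAt.comp_hasFDerivAt x hf.hasFDerivAt
  rw [pd, show (fun x => h (f x)) = h ∘ f from rfl, this.fderiv]; rfl

/-- The divergence theorem for a compactly supported test function and a smooth field. -/
theorem integral_sum_pd_mul {f : EuclideanSpace ℝ (Fin N) → ℝ}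
    {V : Fin N → EuclideanSpace ℝ (Fin N) → ℝ} (hf : ContDiff ℝ ∞ f) (hc : HasCompactSupport f)
    (hV : ∀ j, ContDiff ℝ ∞ (V j)) :
    ∫ x, ∑ j, pd j f x * V j x = -∫ x, f x * ∑ j, pd j (V j) x := by
  have hpc : ∀ j, HasCompactSupport (pd j f) := fun j => hc.fderiv_apply ℝ (stdVec j)
  have i1 : ∀ j, Integrable fun x => pd j f x * V j x := fun j =>
    ((contDiff_pd hf j).continuous.mul (hV j).continuous).integrable_of_hasCompactSupport
      (hpc j).mul_right
  have i2 : ∀ j, Integrable fun x => f x * pd j (V j) x := fun j =>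
    (hf.continuous.mul (contDiff_pd (hV j) j).continuous).integrable_of_hasCompactSupport
      hc.mul_right
  have i3 : ∀ j, Integrable fun x => f x * V j x := fun j =>
    (hf.continuous.mul (hV j).continuous).integrable_of_hasCompactSupport hc.mul_right
  simp_rw [Finset.mul_sum]
  rw [integral_finsetSum _ fun j _ => i1 j, integral_finsetSum _ fun j _ => i2 j,
    ← Finset.sum_neg_distrib]
  refine Finset.sum_congr rfl fun j _ => ?_
  have := integral_mul_fderiv_eq_neg_fderiv_mul_of_integrable (i1 j) (i2 j) (i3 j)
    (fun x _ => hf.differentiable (by simp) x) (fun x _ => (hV j).differentiable (by simp) x)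
  exact (neg_eq_iff_eq_neg.2 this).symm

/-- A smooth function has vanishing gradient almost everywhere on its zero set. -/
theorem ae_pd_eq_zero_of_eq_zero {w : EuclideanSpace ℝ (Fin N) → ℝ} (hw : ContDiff ℝ ∞ w)
    (j : Fin N) : ∀ᵐ x, w x = 0 → pd j w x = 0 := by
  set L : ℝ →L[ℝ] EuclideanSpace ℝ (Fin N) :=
    ContinuousLinearMap.smulRight (1 : ℝ →L[ℝ] ℝ) (stdVec j) with hL
  have hmeas : MeasurableSet {x | w x = 0 → pd j w x = 0} := by
    have h1 : MeasurableSet {x | w x = 0} :=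
      (isClosed_eq hw.continuous continuous_const).measurableSet
    have h2 : MeasurableSet {x | pd j w x = 0} :=
      (isClosed_eq (contDiff_pd hw j).continuous continuous_const).measurableSet
    have : {x | w x = 0 → pd j w x = 0} = {x | w x = 0}ᶜ ∪ {x | pd j w x = 0} := by
      ext x; simp [imp_iff_not_or]
    rw [this]
    exact h1.compl.union h2
  -- By Fubini it suffices to consider lines in the direction of the basis vector. On each of them
  -- the zeros of w with nonzero derivative are isolated, hence countable and null.
  refine ae_mem_of_ae_add_linearMap_mem L.toLinearMap volume volume hmeas fun y => ?_
  set g : ℝ → ℝ := fun t => w (y + t • stdVec j) with hg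
  have hgd : ∀ t, HasDerivAt g (pd j w (y + t • stdVec j)) t := fun t => by
    have h1 : HasDerivAt (fun t : ℝ => y + t • (stdVec j : EuclideanSpace ℝ (Fin N)))
        (stdVec j) t := by
      simpa using ((hasDerivAt_id t).smul_const (stdVec j)).const_add y
    exact ((hw.differentiable (by simp) _).hasFDerivAt).comp_hasDerivAt t h1
  set S : Set ℝ := {t | g t = 0 ∧ pd j w (y + t • stdVec j) ≠ 0} with hS
  have hcount : S.Countable := by
    refine (countable_setOfPred_isolated_right_within (s := S)).mono fun t (ht : t ∈ S) => ?_
    refine Set.mem_ofPred_eq ▸ ⟨ht, ?_⟩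
    have h1 : ∀ᶠ z in 𝓝[≠] t, g z ≠ 0 := (hgd t).eventually_ne ht.2
    have h2 : 𝓝[S ∩ Set.Ioi t] t ≤ 𝓝[≠] t := nhdsWithin_mono _ fun z hz => (ne_of_gt hz.2)
    have h3 : ∀ᶠ z in 𝓝[S ∩ Set.Ioi t] t, z ∈ S ∩ Set.Ioi t := self_mem_nhdsWithin
    refine Filter.eventually_false_iff_eq_bot.1 ?_
    filter_upwards [h2 h1, h3] with z hz1 hz2
    exact hz1 hz2.1.1
  filter_upwards [hcount.ae_notMem volume] with t ht
  change w (y + t • stdVec j) = 0 → pd j w (y + t • stdVec j) = 0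
  intro h0
  by_contra h1
  exact ht ⟨h0, h1⟩

/-- Smooth cutoffs exhausting the space, with bounded derivatives. -/
theorem exists_cutoff_seq (N : ℕ) : ∃ (χ : ℕ → EuclideanSpace ℝ (Fin N) → ℝ) (C : ℝ), 0 ≤ C ∧
    (∀ n, ContDiff ℝ ∞ (χ n)) ∧ (∀ n, HasCompactSupport (χ n)) ∧
    (∀ n x, 0 ≤ χ n x ∧ χ n x ≤ 1) ∧ (∀ n j x, |pd j (χ n) x| ≤ C) ∧
    ∀ x, ∀ᶠ n in atTop, χ n x = 1 ∧ ∀ j, pd j (χ n) x = 0 := by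
  obtain ⟨χ, h1, h2⟩ : ∃ χ : ContDiffBump (0 : EuclideanSpace ℝ (Fin N)),
    χ.rIn = 1 ∧ χ.rOut = 2 := ⟨⟨1, 2, one_pos, one_lt_two⟩, rfl, rfl⟩
  have hχ : ContDiff ℝ ∞ (χ : EuclideanSpace ℝ (Fin N) → ℝ) := χ.contDiff
  set c : ℕ → ℝ := fun n => ((n : ℝ) + 1)⁻¹ with hc
  have hcpos : ∀ n, 0 < c n := fun n => by positivity
  have hcle : ∀ n, c n ≤ 1 := fun n => inv_le_one_of_one_le₀ (by simp)
  have hcont : Continuous (fderiv ℝ (χ : EuclideanSpace ℝ (Fin N) → ℝ)) :=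
    hχ.continuous_fderiv (by simp)
  obtain ⟨C, hC⟩ := hcont.bounded_above_of_compact_support (χ.hasCompactSupport.fderiv ℝ)
  have hC0 : 0 ≤ C := (norm_nonneg _).trans (hC 0)
  have hpd : ∀ n j x, pd j (fun x => χ (c n • x)) x = c n * fderiv ℝ χ (c n • x) (stdVec j) :=
    fun n j x => by
    have := (hχ.differentiable (by simp) (c n • x)).hasFDerivAt.comp x
      ((hasFDerivAt_id x).const_smul (c n))
    rw [pd]
    erw [this.fderiv]
    simp
  refine ⟨fun n x => χ (c n • x), C, hC0, fun n => hχ.comp (contDiff_const_smul (c n)), fun n =>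
    χ.hasCompactSupport.comp_homeomorph (Homeomorph.smulOfNeZero (c n) (hcpos n).ne'),
    fun n x => ⟨χ.nonneg, χ.le_one⟩, fun n j x => ?_, fun x => ?_⟩
  · rw [hpd, abs_mul, abs_of_pos (hcpos n)]
    have h3 : ‖(stdVec j : EuclideanSpace ℝ (Fin N))‖ = 1 := by simp [stdVec]
    have h4 := (fderiv ℝ χ (c n • x)).le_opNorm (stdVec j)
    rw [h3, mul_one, Real.norm_eq_abs] at h4
    calc c n * _ ≤ 1 * C := by
          gcongr
          · exact hcle n
          · exact h4.trans (hC _)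
      _ = C := one_mul C
  · have hlim : Tendsto (fun n => c n * ‖x‖) atTop (𝓝 0) := by
      have := (tendsto_one_div_add_atTop_nhds_zero_nat (𝕜 := ℝ)).mul_const ‖x‖
      simpa [hc] using this
    filter_upwards [hlim.eventually (gt_mem_nhds one_pos)] with n hn
    have hx : ‖c n • x‖ < 1 := by rwa [norm_smul, Real.norm_of_nonneg (hcpos n).le]
    refine ⟨χ.one_of_mem_closedBall (by rw [h1]; simpa using hx.le), fun j => ?_⟩
    rw [hpd]
    have : (χ : EuclideanSpace ℝ (Fin N) → ℝ) =ᶠ[𝓝 (c n • x)] fun _ => 1 := by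
      filter_upwards [continuous_norm.continuousAt.eventually (gt_mem_nhds hx)] with y hy
      exact χ.one_of_mem_closedBall (by rw [h1]; simpa using hy.le)
    rw [this.fderiv_eq]; simp

/-- Test functions approximating `|w|^(p-2) w` together with its gradient. -/
theorem exists_testFun_approx {p : ℝ} (hp : 1 < p) {w : EuclideanSpace ℝ (Fin N) → ℝ}
    (hw : ContDiff ℝ ∞ w) :
    ∃ (φ : ℕ → EuclideanSpace ℝ (Fin N) → ℝ) (C : ℝ), 0 ≤ C ∧ (∀ n, IsTestFun (φ n)) ∧
      (∀ n x, |φ n x| ≤ |w x| ^ (p - 1)) ∧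
      (∀ x, Tendsto (fun n => φ n x) atTop (𝓝 (|w x| ^ (p - 2) * w x))) ∧
      (∀ n j x, |pd j (φ n) x| ≤ C * (|w x| ^ (p - 2) * |pd j w x| + |w x| ^ (p - 1))) ∧
      (∀ n j x, -(C * |w x| ^ (p - 1) * |pd j w x|) ≤ pd j (φ n) x * pd j w x) ∧
      ∀ j x, (w x = 0 → pd j w x = 0) → Tendsto (fun n => pd j (φ n) x) atTop
        (𝓝 ((p - 1) * |w x| ^ (p - 2) * pd j w x)) := by
  obtain ⟨ψ, B, hB, hψs, hψ0, hψd0, hψle, hψd, hψt, hψdt⟩ := exists_smooth_power_truncation hp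
  obtain ⟨χ, M, hM, hχs, hχc, hχ01, hχd, hχt⟩ := exists_cutoff_seq N
  have hφs : ∀ n, ContDiff ℝ ∞ fun x => χ n x * ψ n (w x) := fun n =>
    (hχs n).mul ((hψs n).comp hw)
  have hpd : ∀ n j x, pd j (fun x => χ n x * ψ n (w x)) x
      = χ n x * (deriv (ψ n) (w x) * pd j w x) + ψ n (w x) * pd j (χ n) x := fun n j x => by
    have h1 : DifferentiableAt ℝ (ψ n) (w x) := (hψs n).differentiable (by simp) _
    have h2 : DifferentiableAt ℝ w x := hw.differentiable (by simp) _
    have h3 : DifferentiableAt ℝ (fun x => ψ n (w x)) x := h1.comp x h2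
    rw [pd_mul ((hχs n).differentiable (by simp) x) h3, pd_comp h1 h2]
  have hb2 : ∀ n j x, |ψ n (w x) * pd j (χ n) x| ≤ |w x| ^ (p - 1) * M := fun n j x => by
    rw [abs_mul]
    exact mul_le_mul (hψle n _) (hχd n j x) (abs_nonneg _) (by positivity)
  refine ⟨fun n x => χ n x * ψ n (w x), B + M, by positivity,
    fun n => ⟨hφs n, (hχc n).mul_right⟩, fun n x => ?_, fun x => ?_, fun n j x => ?_,
    fun n j x => ?_, fun j x hx => ?_⟩
  · rw [abs_mul, abs_of_nonneg (hχ01 n x).1]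
    exact (mul_le_of_le_one_left (abs_nonneg _) (hχ01 n x).2).trans (hψle n _)
  · refine (hψt (w x)).congr' ?_
    filter_upwards [hχt x] with n hn
    rw [hn.1, one_mul]
  · rw [hpd]
    have h1 : |χ n x * (deriv (ψ n) (w x) * pd j w x)| ≤ B * |w x| ^ (p - 2) * |pd j w x| := by
      rw [abs_mul, abs_mul, abs_of_nonneg (hχ01 n x).1, abs_of_nonneg (hψd n _).1]
      refine (mul_le_of_le_one_left (mul_nonneg (hψd n _).1 (abs_nonneg _)) (hχ01 n x).2).trans ?_
      gcongr
      exact (hψd n _).2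
    refine (abs_add_le _ _).trans ((add_le_add h1 (hb2 n j x)).trans ?_)
    have h3 : 0 ≤ |w x| ^ (p - 2) * |pd j w x| := by positivity
    have h4 : 0 ≤ |w x| ^ (p - 1) := by positivity
    nlinarith [mul_nonneg hM h3, mul_nonneg hB h4]
  -- The term containing ψ' is nonnegative; only the derivative of the spatial cutoff can make the
  -- product negative. The resulting minorant is free of the singular weight |w|^(p-2) and so is
  -- available before the energy is known to be finite.
  · rw [hpd, add_mul]
    have h1 : 0 ≤ χ n x * (deriv (ψ n) (w x) * pd j w x) * pd j w x := by
      have := mul_nonneg (mul_nonneg (hχ01 n x).1 (hψd n (w x)).1) (mul_self_nonneg (pd j w x))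
      linarith
    have h2 : |ψ n (w x) * pd j (χ n) x * pd j w x| ≤ (B + M) * |w x| ^ (p - 1) * |pd j w x| := by
      rw [abs_mul]
      gcongr
      refine (hb2 n j x).trans ?_
      rw [mul_comm]
      gcongr
      linarith
    linarith [neg_abs_le (ψ n (w x) * pd j (χ n) x * pd j w x)]
  · by_cases h0 : w x = 0
    -- At a zero of w both sides vanish, whatever value Lean gives to `0 ^ (p - 2)`, because the
    -- derivative of w vanishes there.
    · refine tendsto_const_nhds.congr fun n => ?_
      rw [hpd, hx h0, h0, hψ0]
      simp
    · refine ((hψdt (w x) h0).mul_const (pd j w x)).congr' ?_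
      filter_upwards [hχt x] with n hn
      rw [hpd, hn.1, hn.2]
      ring

end PartialDeriv

/-! ### Integrability of the energy density and the weak chain rule. -/

section Energy

variable {N : ℕ} {p : ℝ} {w : EuclideanSpace ℝ (Fin N) → ℝ}

theorem memLp_abs_rpow_sub_one {α : Type*} [MeasurableSpace α] {μ : Measure α} {f : α → ℝ}
    (hp : 1 < p) (hf : MemLp f (ENNReal.ofReal p) μ) :
    MemLp (fun x => |f x| ^ (p - 1)) (ENNReal.ofReal p.conjExponent) μ := by
  have h := hf.norm_rpow_div (ENNReal.ofReal (p - 1))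
  rw [ENNReal.toReal_ofReal (by linarith), ← ENNReal.ofReal_div_of_pos (by linarith)] at h
  exact h

theorem integrable_abs_rpow_sub_one_mul {α : Type*} [MeasurableSpace α] {μ : Measure α}
    {f g : α → ℝ} (hp : 1 < p) (hf : MemLp f (ENNReal.ofReal p) μ)
    (hg : MemLp g (ENNReal.ofReal p) μ) : Integrable (fun x => |f x| ^ (p - 1) * g x) μ := by
  have hpq := (Real.HolderConjugate.conjExponent hp).symm.ennrealOfReal
  exact memLp_one_iff_integrable.1 (hg.mul (memLp_abs_rpow_sub_one hp hf))

/-- The energy density `|w|^(p-2) |∇w|²` is integrable. -/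
theorem integrable_energy (hp : 1 < p) (hw : ContDiff ℝ ∞ w)
    (hwp : MemLp w (ENNReal.ofReal p)) (hD : ∀ j, MemLp (pd j w) (ENNReal.ofReal p))
    (hL : MemLp (fun x => ∑ j, pd j (pd j w) x) (ENNReal.ofReal p)) :
    Integrable fun x => ‖∇ w x‖ ^ 2 * |w x| ^ (p - 2) := by
  obtain ⟨φ, C, hC, hφ, hφle, -, -, hφlow, hφlim⟩ := exists_testFun_approx hp hw
  have iD : Integrable fun x => ∑ j, C * (|w x| ^ (p - 1) * |pd j w x|) :=
    integrable_finsetSum _ fun j _ =>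
      (integrable_abs_rpow_sub_one_mul hp hwp (hD j).abs).const_mul C
  have iL : Integrable fun x => |w x| ^ (p - 1) * |∑ j, pd j (pd j w) x| :=
    integrable_abs_rpow_sub_one_mul hp hwp hL.abs
  -- Adding the integrable minorant makes ∇φ_n·∇w nonnegative, as Fatou's lemma requires.
  set h : ℕ → EuclideanSpace ℝ (Fin N) → ℝ := fun n x =>
    (∑ j, pd j (φ n) x * pd j w x) + ∑ j, C * (|w x| ^ (p - 1) * |pd j w x|) with hh
  set H : EuclideanSpace ℝ (Fin N) → ℝ := fun x =>
    (∑ j, (p - 1) * |w x| ^ (p - 2) * pd j w x * pd j w x)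
      + ∑ j, C * (|w x| ^ (p - 1) * |pd j w x|) with hH
  have i1 : ∀ n, Integrable fun x => ∑ j, pd j (φ n) x * pd j w x := fun n =>
    integrable_finsetSum _ fun j _ =>
      ((contDiff_pd (hφ n).1 j).continuous.mul
        (contDiff_pd hw j).continuous).integrable_of_hasCompactSupport
        ((hφ n).2.fderiv_apply ℝ (stdVec j)).mul_right
  have ih : ∀ n, Integrable (h n) := fun n => (i1 n).add iD
  have hpos : ∀ n x, 0 ≤ h n x := fun n x => by
    rw [hh]
    simp only
    rw [← Finset.sum_add_distrib]
    exact Finset.sum_nonneg fun j _ => by linarith [hφlow n j x]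
  have hlim : ∀ᵐ x, Tendsto (fun n => h n x) atTop (𝓝 (H x)) := by
    filter_upwards [ae_all_iff.2 fun j => ae_pd_eq_zero_of_eq_zero hw j] with x hx
    exact (tendsto_finsetSum _ fun j _ => (hφlim j x (hx j)).mul_const _).add_const _
  have hHpos : 0 ≤ᵐ[volume] H := by
    filter_upwards [hlim] with x hx
    exact ge_of_tendsto' hx fun n => hpos n x
  -- A bound independent of n: integration by parts turns ∫∇φ_n·∇w into -∫φ_n Δw, and |φ_n| ≤
  -- |w|^(p-1).
  set M : ℝ := (∫ x, |w x| ^ (p - 1) * |∑ j, pd j (pd j w) x|)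
    + ∫ x, ∑ j, C * (|w x| ^ (p - 1) * |pd j w x|) with hM
  have hbd : ∀ n, ∫⁻ x, ENNReal.ofReal (h n x) ≤ ENNReal.ofReal M := fun n => by
    rw [← ofReal_integral_eq_lintegral_ofReal (ih n) (Eventually.of_forall (hpos n))]
    refine ENNReal.ofReal_le_ofReal ?_
    rw [hh]
    simp only
    rw [integral_add (i1 n) iD, integral_sum_pd_mul (hφ n).1 (hφ n).2 fun j => contDiff_pd hw j,
      ← integral_neg, hM]
    gcongr
    · have hLc : Continuous fun x => ∑ j, pd j (pd j w) x :=
        continuous_finsetSum _ fun j _ => (contDiff_pd (contDiff_pd hw j) j).continuous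
      exact (((hφ n).1.continuous.mul hLc).integrable_of_hasCompactSupport (hφ n).2.mul_right).neg
    · intro x
      simp only
      refine (neg_le_abs _).trans ?_
      rw [abs_mul]
      gcongr
      exact hφle n x
  have hmeas : AEStronglyMeasurable H volume :=
    aestronglyMeasurable_of_tendsto_ae _ (fun n => (ih n).aestronglyMeasurable) hlim
  have iH : Integrable H := by
    refine ⟨hmeas, ?_⟩
    rw [hasFiniteIntegral_iff_ofReal hHpos]
    have h1 : ∫⁻ x, ENNReal.ofReal (H x) = ∫⁻ x, liminf (fun n => ENNReal.ofReal (h n x)) atTop := by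
      refine lintegral_congr_ae ?_
      filter_upwards [hlim] with x hx
      exact ((ENNReal.continuous_ofReal.tendsto _).comp hx).liminf_eq.symm
    rw [h1]
    refine (lintegral_liminf_le' fun n => (ih n).aemeasurable.ennreal_ofReal).trans_lt ?_
    refine lt_of_le_of_lt (liminf_le_of_le (h := fun b hb => ?_)) (ENNReal.ofReal_lt_top (r := M))
    obtain ⟨n, hn⟩ := hb.exists
    exact hn.trans (hbd n)
  have h2 : (fun x => ‖∇ w x‖ ^ 2 * |w x| ^ (p - 2)) = fun x => (p - 1)⁻¹ *
      (H x - ∑ j, C * (|w x| ^ (p - 1) * |pd j w x|)) := by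
    ext x
    have hp1 : p - 1 ≠ 0 := by linarith
    rw [hH]
    simp only
    rw [add_sub_cancel_right, norm_gradient_sq, Finset.sum_mul, Finset.mul_sum]
    refine Finset.sum_congr rfl fun j _ => ?_
    field_simp
  rw [h2]
  exact (iH.sub iD).const_mul _

/-- Weak form of `∇ (|w|^(p-2) w) = (p-1) |w|^(p-2) ∇w`, tested against a smooth field. -/
theorem integral_power_mul_div (hp : 1 < p) (hw : ContDiff ℝ ∞ w)
    {V : Fin N → EuclideanSpace ℝ (Fin N) → ℝ} (hV : ∀ j, ContDiff ℝ ∞ (V j))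
    (h1 : Integrable fun x => |w x| ^ (p - 1) * |∑ j, pd j (V j) x|)
    (h2 : ∀ j, Integrable fun x => |w x| ^ (p - 1) * |V j x|)
    (h3 : ∀ j, Integrable fun x => |w x| ^ (p - 2) * |pd j w x| * |V j x|) :
    ∫ x, |w x| ^ (p - 2) * w x * ∑ j, pd j (V j) x
      = -∫ x, ∑ j, (p - 1) * |w x| ^ (p - 2) * pd j w x * V j x := by
  obtain ⟨φ, C, hC, hφ, hφle, hφt, hφd, -, hφlim⟩ := exists_testFun_approx hp hw
  have hdivc : Continuous fun x => ∑ j, pd j (V j) x :=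
    continuous_finsetSum _ fun j _ => (contDiff_pd (hV j) j).continuous
  have t1 : Tendsto (fun n => ∫ x, φ n x * ∑ j, pd j (V j) x) atTop
      (𝓝 (∫ x, |w x| ^ (p - 2) * w x * ∑ j, pd j (V j) x)) := by
    refine tendsto_integral_of_dominated_convergence _
      (fun n => ((hφ n).1.continuous.mul hdivc).aestronglyMeasurable) h1
      (fun n => Eventually.of_forall fun x => ?_)
      (Eventually.of_forall fun x => (hφt x).mul_const _)
    rw [norm_mul, Real.norm_eq_abs, Real.norm_eq_abs]
    gcongr
    exact hφle n x
  have hbd : Integrable fun x => ∑ j, C * (|w x| ^ (p - 2) * |pd j w x| * |V j x|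
      + |w x| ^ (p - 1) * |V j x|) :=
    integrable_finsetSum _ fun j _ => ((h3 j).add (h2 j)).const_mul C
  have t2 : Tendsto (fun n => ∫ x, ∑ j, pd j (φ n) x * V j x) atTop
      (𝓝 (∫ x, ∑ j, (p - 1) * |w x| ^ (p - 2) * pd j w x * V j x)) := by
    refine tendsto_integral_of_dominated_convergence _
      (fun n => (continuous_finsetSum _ fun j _ => (contDiff_pd (hφ n).1 j).continuous.mul
        (hV j).continuous).aestronglyMeasurable) hbd
      (fun n => Eventually.of_forall fun x => ?_) ?_
    · refine (norm_sum_le _ _).trans (Finset.sum_le_sum fun j _ => ?_)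
      rw [norm_mul, Real.norm_eq_abs, Real.norm_eq_abs]
      refine (mul_le_mul_of_nonneg_right (hφd n j x) (abs_nonneg _)).trans (le_of_eq ?_)
      ring
    · filter_upwards [ae_all_iff.2 fun j => ae_pd_eq_zero_of_eq_zero hw j] with x hx
      exact tendsto_finsetSum _ fun j _ => (hφlim j x (hx j)).mul_const _
  refine tendsto_nhds_unique t1 (t2.neg.congr fun n => ?_)
  rw [integral_sum_pd_mul (hφ n).1 (hφ n).2 hV, neg_neg]

/-! ### The Poincaré-type inequality for the energy. -/

theorem rpow_sub_two_mul_sq_le (hp : 2 ≤ p) {a b : ℝ} (ha : 0 ≤ a) (hb : 0 ≤ b) :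
    a ^ (p - 2) * b ^ 2 ≤ (1 - 2 / p) * a ^ p + 2 / p * b ^ p := by
  have hp0 : 0 < p := by linarith
  have h := Real.geom_mean_le_arith_mean2_weighted (w₁ := 1 - 2 / p) (w₂ := 2 / p)
    (p₁ := a ^ p) (p₂ := b ^ p) (by rw [sub_nonneg, div_le_one hp0]; exact hp) (by positivity)
    (by positivity) (by positivity) (by ring)
  rw [← Real.rpow_mul ha, ← Real.rpow_mul hb, mul_div_cancel₀ _ hp0.ne', Real.rpow_two] at h
  rwa [show p * (1 - 2 / p) = p - 2 by field_simp] at h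

/-- Young's inequality for b^p = (b² a^(p-2))^(p/2) (a^p)^(1-p/2), the pointwise form of the Hölder
interpolation between energy and L^p norm. The negative power of a forces a > 0. -/
theorem rpow_le_of_lt_two (hp : 1 < p) (hp2 : p < 2) {a b : ℝ} (ha : 0 < a) (hb : 0 ≤ b) :
    b ^ p ≤ p / 2 * (b ^ 2 * a ^ (p - 2)) + (1 - p / 2) * a ^ p := by
  have hp0 : 0 < p := by linarith
  have h := Real.geom_mean_le_arith_mean2_weighted (w₁ := p / 2) (w₂ := 1 - p / 2)
    (p₁ := b ^ 2 * a ^ (p - 2)) (p₂ := a ^ p) (by positivity) (by linarith)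
    (by positivity) (by positivity) (by ring)
  refine le_trans (le_of_eq ?_) h
  rw [Real.mul_rpow (by positivity) (by positivity), ← Real.rpow_two, ← Real.rpow_mul hb,
    ← Real.rpow_mul ha.le, ← Real.rpow_mul ha.le, mul_assoc, ← Real.rpow_add ha,
    show (p - 2) * (p / 2) + p * (1 - p / 2) = 0 by ring, Real.rpow_zero, mul_one]
  congr 1; ring

open LineDeriv in
theorem sum_schwartzConv {p : ℝ} (hp : 1 < p) {u : EuclideanSpace ℝ (Fin N) → ℝ}
    (hu : MemLp u (ENNReal.ofReal p)) (K : Fin N → 𝓢(EuclideanSpace ℝ (Fin N), ℝ))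
    (x : EuclideanSpace ℝ (Fin N)) :
    schwartzConv (∑ j, K j) u x = ∑ j, schwartzConv (K j) u x := by
  simp only [schwartzConv]
  rw [← integral_finsetSum _ fun j _ => integrable_schwartzConv hp hu (K j) x]
  refine integral_congr_ae (Eventually.of_forall fun y => ?_)
  simp only [FunLike.coe_sum, Finset.sum_apply, Finset.smul_sum]

theorem integrable_energy_pd (hw : ContDiff ℝ ∞ w)
    (hE : Integrable fun x => ‖∇ w x‖ ^ 2 * |w x| ^ (p - 2)) (j : Fin N) :
    Integrable fun x => pd j w x ^ 2 * |w x| ^ (p - 2) := by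
  have hm : Measurable fun x => pd j w x ^ 2 * |w x| ^ (p - 2) :=
    ((contDiff_pd hw j).continuous.measurable.pow_const 2).mul
      (hw.continuous.abs.measurable.pow_const _)
  refine hE.mono hm.aestronglyMeasurable (Eventually.of_forall fun x => ?_)
  rw [Real.norm_of_nonneg (by positivity), Real.norm_of_nonneg (by positivity)]
  have h : pd j w x ^ 2 ≤ ‖∇ w x‖ ^ 2 := by
    rw [← sq_abs]
    exact pow_le_pow_left₀ (abs_nonneg _) (abs_pd_le_norm_gradient w x j) 2
  gcongr

theorem integral_energy_eq_sum (hw : ContDiff ℝ ∞ w)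
    (hE : Integrable fun x => ‖∇ w x‖ ^ 2 * |w x| ^ (p - 2)) :
    ∫ x, ‖∇ w x‖ ^ 2 * |w x| ^ (p - 2) = ∑ j, ∫ x, pd j w x ^ 2 * |w x| ^ (p - 2) := by
  rw [← integral_finsetSum _ fun j _ => integrable_energy_pd hw hE j]
  simp_rw [norm_gradient_sq, Finset.sum_mul]

open LineDeriv in
-- From w = ∑ G_j * ∂_j w and Young's convolution inequality, X is bounded by the integrals of |∂_j
-- w|^p. Each of these is interpolated between the energy and X; the share of X is 1 - p/2 < 1 and
-- is absorbed.
theorem integral_rpow_le_energy_of_lt_two (hN : 1 ≤ N) (hp : 1 < p) (hp2 : p < 2)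
    (hw : ContDiff ℝ ∞ w) (hwp : MemLp w (ENNReal.ofReal p))
    (hD : ∀ j, MemLp (pd j w) (ENNReal.ofReal p))
    (hE : Integrable fun x => ‖∇ w x‖ ^ 2 * |w x| ^ (p - 2))
    {G : Fin N → 𝓢(EuclideanSpace ℝ (Fin N), ℝ)} {b : ℝ} (hb : 0 < b)
    (hG : ∀ j, ∫ x, ‖G j x‖ ≤ b)
    (hrep : ∀ x, w x = schwartzConv (∑ j, ∂_{stdVec j} (G j)) w x) :
    ∫ x, |w x| ^ p ≤ (N * b) ^ 2 * ∫ x, ‖∇ w x‖ ^ 2 * |w x| ^ (p - 2) := by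
  have hN0 : (1 : ℝ) ≤ N := by exact_mod_cast hN
  have hNpos : (0 : ℝ) < N := by linarith
  -- With this t, N^(p-1) b^p = N⁻¹ t^p, so the N interpolated terms are averaged and contribute
  -- exactly (1 - p/2) X.
  set t : ℝ := N * b with ht
  have ht0 : 0 < t := by positivity
  set X : ℝ := ∫ x, |w x| ^ p with hX
  have iX : Integrable fun x => |w x| ^ p := hwp.integrable_norm_rpow_ofReal hp
  have hX0 : 0 ≤ X := integral_nonneg fun x => by positivity
  have hrep' : ∀ x, w x = ∑ j, schwartzConv (G j) (pd j w) x := fun x => by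
    rw [hrep x, sum_schwartzConv hp hwp]
    exact Finset.sum_congr rfl fun j _ =>
      schwartzConv_lineDeriv hp hwp (hw.differentiable (by simp)) (hD j) (G j) x
  have iG : ∀ j, Integrable fun x => |schwartzConv (G j) (pd j w) x| ^ p := fun j =>
    (memLp_schwartzConv hp (hD j) (G j)).integrable_norm_rpow_ofReal hp
  have iD : ∀ j, Integrable fun x => |pd j w x| ^ p := fun j => (hD j).integrable_norm_rpow_ofReal hp
  have h1 : X ≤ (N : ℝ) ^ (p - 1) * ∑ j, ∫ x, |schwartzConv (G j) (pd j w) x| ^ p := by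
    rw [← integral_finsetSum _ fun j _ => iG j, ← integral_const_mul]
    refine integral_mono iX ((integrable_finsetSum _ fun j _ => iG j).const_mul _) fun x => ?_
    simp only
    calc |w x| ^ p ≤ (∑ j, |schwartzConv (G j) (pd j w) x|) ^ p := by
          gcongr
          nth_rewrite 1 [hrep' x]
          exact Finset.abs_sum_le_sum_abs _ _
      _ ≤ _ := by
        have := Real.rpow_sum_le_const_mul_sum_rpow_of_nonneg (s := Finset.univ)
          (f := fun j => |schwartzConv (G j) (pd j w) x|) (p := p) hp.le fun j _ => abs_nonneg _
        simpa using this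
  have h2 : ∀ j, ∫ x, |schwartzConv (G j) (pd j w) x| ^ p ≤ b ^ p * ∫ x, |pd j w x| ^ p := fun j => by
    refine (integral_norm_schwartzConv_rpow_le hp (hD j) (G j)).trans ?_
    have : 0 ≤ ∫ x, ‖G j x‖ := integral_nonneg fun x => norm_nonneg _
    have h0 : 0 ≤ ∫ x, ‖pd j w x‖ ^ p := integral_nonneg fun x => by positivity
    exact mul_le_mul_of_nonneg_right (Real.rpow_le_rpow this (hG j) (by linarith)) h0
  have h3 : ∀ j, t ^ p * ∫ x, |pd j w x| ^ p
      ≤ p / 2 * (t ^ 2 * ∫ x, pd j w x ^ 2 * |w x| ^ (p - 2)) + (1 - p / 2) * X := fun j => by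
    have iA := integrable_energy_pd hw hE j
    rw [← integral_const_mul, ← integral_const_mul, ← integral_const_mul, hX, ← integral_const_mul,
      ← integral_add ((iA.const_mul _).const_mul _) (iX.const_mul _)]
    refine integral_mono_ae ((iD j).const_mul _)
      (((iA.const_mul _).const_mul _).add (iX.const_mul _)) ?_
    filter_upwards [ae_pd_eq_zero_of_eq_zero hw j] with x hx
    rcases eq_or_ne (w x) 0 with h0 | h0
    · rw [hx h0, h0]
      simp [Real.zero_rpow (show p ≠ 0 by linarith)]
    · have := rpow_le_of_lt_two hp hp2 (abs_pos.2 h0) (b := t * |pd j w x|) (by positivity)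
      rw [Real.mul_rpow ht0.le (abs_nonneg _), mul_pow, sq_abs] at this
      linarith
  have h4 : X ≤ (N : ℝ)⁻¹ * ∑ j, t ^ p * ∫ x, |pd j w x| ^ p := by
    refine h1.trans ?_
    calc (N : ℝ) ^ (p - 1) * ∑ j, ∫ x, |schwartzConv (G j) (pd j w) x| ^ p
        ≤ (N : ℝ) ^ (p - 1) * ∑ j, b ^ p * ∫ x, |pd j w x| ^ p := by
          gcongr with j _; exact h2 j
      _ = _ := by
        rw [Finset.mul_sum, Finset.mul_sum]
        refine Finset.sum_congr rfl fun j _ => ?_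
        rw [ht, Real.mul_rpow hNpos.le hb.le, Real.rpow_sub_one hNpos.ne']
        field_simp
  have h5 : X ≤ (N : ℝ)⁻¹ * ∑ j, (p / 2 * (t ^ 2 * ∫ x, pd j w x ^ 2 * |w x| ^ (p - 2))
      + (1 - p / 2) * X) := by
    refine h4.trans ?_
    gcongr with j _
    exact h3 j
  rw [Finset.sum_add_distrib, ← Finset.mul_sum, ← Finset.mul_sum, ← integral_energy_eq_sum hw hE,
    Finset.sum_const, Finset.card_univ, Fintype.card_fin, nsmul_eq_mul, mul_add,
    inv_mul_cancel_left₀ hNpos.ne'] at h5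
  set A : ℝ := ∫ x, ‖∇ w x‖ ^ 2 * |w x| ^ (p - 2)
  have hA0 : 0 ≤ A := integral_nonneg fun x => by positivity
  have h6 : (N : ℝ)⁻¹ * (p / 2 * (t ^ 2 * A)) ≤ p / 2 * (t ^ 2 * A) :=
    mul_le_of_le_one_left (by positivity) (inv_le_one_of_one_le₀ hN0)
  have h7 : p / 2 * X ≤ p / 2 * (t ^ 2 * A) := by linarith
  exact le_of_mul_le_mul_left h7 (by linarith)

open LineDeriv in
-- Since w = div V for V = G * w, X is -(p-1)∫|w|^(p-2) ∇w·V. A weighted Cauchy–Schwarz inequality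
-- splits this into the energy and ∫|w|^(p-2) V_j², and the latter is at most a multiple of X
-- because ‖V_j‖_p ≤ b‖w‖_p.
theorem integral_rpow_le_energy_of_two_le (hN : 1 ≤ N) (hp2 : 2 ≤ p)
    (hw : ContDiff ℝ ∞ w) (hwp : MemLp w (ENNReal.ofReal p))
    (hE : Integrable fun x => ‖∇ w x‖ ^ 2 * |w x| ^ (p - 2))
    {G : Fin N → 𝓢(EuclideanSpace ℝ (Fin N), ℝ)} {b : ℝ} (hb : 0 < b)
    (hG : ∀ j, ∫ x, ‖G j x‖ ≤ b)
    (hrep : ∀ x, w x = schwartzConv (∑ j, ∂_{stdVec j} (G j)) w x) :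
    ∫ x, |w x| ^ p ≤ (p - 1) ^ 2 * ((N * b) ^ 2 * ∫ x, ‖∇ w x‖ ^ 2 * |w x| ^ (p - 2)) := by
  have hp : 1 < p := by linarith
  have hp0 : 0 < p := by linarith
  have hN0 : (1 : ℝ) ≤ N := by exact_mod_cast hN
  have hNpos : (0 : ℝ) < N := by linarith
  set X : ℝ := ∫ x, |w x| ^ p with hX
  have iX : Integrable fun x => |w x| ^ p := hwp.integrable_norm_rpow_ofReal hp
  have hX0 : 0 ≤ X := integral_nonneg fun x => by positivity
  set V : Fin N → EuclideanSpace ℝ (Fin N) → ℝ := fun j => schwartzConv (G j) w with hV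
  have hVs : ∀ j, ContDiff ℝ ∞ (V j) := fun j => contDiff_schwartzConv hp hwp (G j)
  have hVp : ∀ j, MemLp (V j) (ENNReal.ofReal p) := fun j => memLp_schwartzConv hp hwp (G j)
  have iV : ∀ j, Integrable fun x => |V j x| ^ p := fun j => (hVp j).integrable_norm_rpow_ofReal hp
  have hdiv : ∀ x, ∑ j, pd j (V j) x = w x := fun x => by
    rw [hrep x, sum_schwartzConv hp hwp]
    exact Finset.sum_congr rfl fun j _ => fderiv_schwartzConv_apply hp hwp (G j) x _
  -- This normalises V: the p-th power integral of t V_j is at most X.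
  set t : ℝ := b⁻¹ with ht
  have ht0 : 0 < t := by positivity
  have hVX : ∀ j, t ^ p * ∫ x, |V j x| ^ p ≤ X := fun j => by
    have h1 : ∫ x, |V j x| ^ p ≤ b ^ p * X := by
      refine (integral_norm_schwartzConv_rpow_le hp hwp (G j)).trans ?_
      have : 0 ≤ ∫ x, ‖G j x‖ := integral_nonneg fun x => norm_nonneg _
      change _ * X ≤ _
      gcongr
      exact hG j
    calc t ^ p * ∫ x, |V j x| ^ p ≤ t ^ p * (b ^ p * X) := by gcongr
      _ = X := by
        rw [← mul_assoc, ← Real.mul_rpow ht0.le hb.le, ht, inv_mul_cancel₀ hb.ne', Real.one_rpow,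
          one_mul]
  have hpt : ∀ j x, t ^ 2 * (|w x| ^ (p - 2) * V j x ^ 2)
      ≤ (1 - 2 / p) * |w x| ^ p + 2 / p * (t ^ p * |V j x| ^ p) := fun j x => by
    have := rpow_sub_two_mul_sq_le hp2 (abs_nonneg (w x)) (b := t * |V j x|) (by positivity)
    rw [Real.mul_rpow ht0.le (abs_nonneg _), mul_pow, sq_abs] at this
    linarith
  have mV : ∀ j, Measurable fun x => |w x| ^ (p - 2) * V j x ^ 2 := fun j =>
    (hw.continuous.abs.measurable.pow_const _).mul ((hVs j).continuous.measurable.pow_const 2)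
  have iB : ∀ j, Integrable fun x => (1 - 2 / p) * |w x| ^ p + 2 / p * (t ^ p * |V j x| ^ p) :=
    fun j => (iX.const_mul _).add (((iV j).const_mul _).const_mul _)
  have iW' : ∀ j, Integrable fun x => t ^ 2 * (|w x| ^ (p - 2) * V j x ^ 2) := fun j => by
    refine (iB j).mono ((mV j).const_mul _).aestronglyMeasurable (Eventually.of_forall fun x => ?_)
    rw [Real.norm_of_nonneg (by positivity), Real.norm_eq_abs]
    exact (hpt j x).trans (le_abs_self _)
  have hWX : ∀ j, ∫ x, t ^ 2 * (|w x| ^ (p - 2) * V j x ^ 2) ≤ X := fun j => by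
    refine (integral_mono (iW' j) (iB j) (hpt j)).trans ?_
    rw [integral_add (iX.const_mul _) (((iV j).const_mul _).const_mul _), integral_const_mul,
      integral_const_mul, integral_const_mul]
    have h1 : 2 / p * (t ^ p * ∫ x, |V j x| ^ p) ≤ 2 / p * X := by
      gcongr; exact hVX j
    calc _ ≤ (1 - 2 / p) * X + 2 / p * X := by gcongr
      _ = X := by ring
  -- Chosen so that s t = (p-1)N: each of the N Cauchy–Schwarz terms then carries X/(2N), and their
  -- sum X/2 is absorbed.
  obtain ⟨s, hs⟩ : ∃ s : ℝ, s = (p - 1) * (N * b) := ⟨_, rfl⟩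
  have hs0 : 0 < s := hs ▸ mul_pos (by linarith) (by positivity)
  have hst : s * t = (p - 1) * N := by
    rw [hs, ht]; field_simp
  have iA := fun j => integrable_energy_pd hw hE j
  have hcs : ∀ j x, (p - 1) * (|w x| ^ (p - 2) * |pd j w x| * |V j x|)
      ≤ (2 * N : ℝ)⁻¹ * (s ^ 2 * (pd j w x ^ 2 * |w x| ^ (p - 2))
        + t ^ 2 * (|w x| ^ (p - 2) * V j x ^ 2)) := fun j x => by
    have h0 : 0 ≤ |w x| ^ (p - 2) := by positivity
    have h1 : 2 * ((s * |pd j w x|) * (t * |V j x|)) ≤ s ^ 2 * pd j w x ^ 2 + t ^ 2 * V j x ^ 2 := by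
      have := two_mul_le_add_sq (s * |pd j w x|) (t * |V j x|)
      rw [mul_pow, mul_pow, sq_abs, sq_abs] at this
      linarith
    have h2 : 2 * ((s * |pd j w x|) * (t * |V j x|)) = 2 * N * ((p - 1) * (|pd j w x| * |V j x|)) := by
      linear_combination (2 * |pd j w x| * |V j x|) * hst
    rw [h2] at h1
    have h3 := mul_le_mul_of_nonneg_left h1 h0
    rw [← div_eq_inv_mul, le_div_iff₀ (by positivity)]
    linarith
  have iR : ∀ j, Integrable fun x => (2 * N : ℝ)⁻¹ * (s ^ 2 * (pd j w x ^ 2 * |w x| ^ (p - 2))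
        + t ^ 2 * (|w x| ^ (p - 2) * V j x ^ 2)) := fun j =>
    (((iA j).const_mul _).add (iW' j)).const_mul _
  have iC' : ∀ j, Integrable fun x => (p - 1) * (|w x| ^ (p - 2) * |pd j w x| * |V j x|) := fun j => by
    have hm : Measurable fun x => (p - 1) * (|w x| ^ (p - 2) * |pd j w x| * |V j x|) :=
      (((hw.continuous.abs.measurable.pow_const _).mul
        (contDiff_pd hw j).continuous.abs.measurable).mul
        (hVs j).continuous.abs.measurable).const_mul _
    refine (iR j).mono hm.aestronglyMeasurable (Eventually.of_forall fun x => ?_)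
    rw [Real.norm_of_nonneg (mul_nonneg (by linarith) (by positivity)), Real.norm_eq_abs]
    exact (hcs j x).trans (le_abs_self _)
  have iC : ∀ j, Integrable fun x => |w x| ^ (p - 2) * |pd j w x| * |V j x| := fun j => by
    refine ((iC' j).const_mul (p - 1)⁻¹).congr (Eventually.of_forall fun x => ?_)
    have : p - 1 ≠ 0 := by linarith
    simp only
    field_simp
  have hid := integral_power_mul_div hp hw hVs
    (by simp_rw [hdiv]; exact integrable_abs_rpow_sub_one_mul hp hwp hwp.abs)
    (fun j => integrable_abs_rpow_sub_one_mul hp hwp (hVp j).abs) iC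
  have hXeq : ∫ x, |w x| ^ (p - 2) * w x * ∑ j, pd j (V j) x = X := by
    refine integral_congr_ae (Eventually.of_forall fun x => ?_)
    simp only
    rw [hdiv, mul_assoc, ← pow_two, ← sq_abs, ← Real.rpow_two]
    rcases eq_or_ne (w x) 0 with h0 | h0
    · simp [h0, Real.zero_rpow hp0.ne']
    · rw [← Real.rpow_add (abs_pos.2 h0)]; congr 1; ring
  rw [hXeq, ← integral_neg] at hid
  set A : ℝ := ∫ x, ‖∇ w x‖ ^ 2 * |w x| ^ (p - 2)
  have h1 : X ≤ ∑ j, (2 * N : ℝ)⁻¹ * (s ^ 2 * (∫ x, pd j w x ^ 2 * |w x| ^ (p - 2)) + X) := by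
    have hR := integrable_finsetSum Finset.univ fun j _ => iR j
    have h2 : X ≤ ∫ x, ∑ j, (2 * N : ℝ)⁻¹ * (s ^ 2 * (pd j w x ^ 2 * |w x| ^ (p - 2))
          + t ^ 2 * (|w x| ^ (p - 2) * V j x ^ 2)) := by
      rw [hid]
      refine (le_abs_self _).trans ?_
      rw [← Real.norm_eq_abs]
      refine norm_integral_le_of_norm_le hR (Eventually.of_forall fun x => ?_)
      rw [norm_neg]
      refine (norm_sum_le _ _).trans (Finset.sum_le_sum fun j _ => ?_)
      refine le_trans (le_of_eq ?_) (hcs j x)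
      rw [Real.norm_eq_abs, abs_mul, abs_mul, abs_mul, abs_of_nonneg (show 0 ≤ p - 1 by linarith),
        abs_of_nonneg (show 0 ≤ |w x| ^ (p - 2) by positivity)]
      ring
    refine h2.trans ?_
    rw [integral_finsetSum _ fun j _ => iR j]
    refine Finset.sum_le_sum fun j _ => ?_
    rw [integral_const_mul, integral_add ((iA j).const_mul _) (iW' j), integral_const_mul (s ^ 2)]
    gcongr
    exact hWX j
  rw [← Finset.mul_sum, Finset.sum_add_distrib, ← Finset.mul_sum, ← integral_energy_eq_sum hw hE,
    Finset.sum_const, Finset.card_univ, Fintype.card_fin, nsmul_eq_mul] at h1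
  set A : ℝ := ∫ x, ‖∇ w x‖ ^ 2 * |w x| ^ (p - 2)
  have hA0 : 0 ≤ A := integral_nonneg fun x => by positivity
  have h2 : (2 * N : ℝ)⁻¹ * (s ^ 2 * A + N * X) = (N : ℝ)⁻¹ * (s ^ 2 * A) / 2 + X / 2 := by
    field_simp
  have h3 : (N : ℝ)⁻¹ * (s ^ 2 * A) ≤ s ^ 2 * A :=
    mul_le_of_le_one_left (by positivity) (inv_le_one_of_one_le₀ hN0)
  have h4 : s ^ 2 * A = (p - 1) ^ 2 * ((N * b) ^ 2 * A) := by rw [hs]; ring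
  linarith

open LineDeriv in
theorem integral_rpow_le_energy (hN : 1 ≤ N) (hp : 1 < p)
    (hw : ContDiff ℝ ∞ w) (hwp : MemLp w (ENNReal.ofReal p))
    (hD : ∀ j, MemLp (pd j w) (ENNReal.ofReal p))
    (hE : Integrable fun x => ‖∇ w x‖ ^ 2 * |w x| ^ (p - 2))
    {G : Fin N → 𝓢(EuclideanSpace ℝ (Fin N), ℝ)} {b : ℝ} (hb : 0 < b)
    (hG : ∀ j, ∫ x, ‖G j x‖ ≤ b)
    (hrep : ∀ x, w x = schwartzConv (∑ j, ∂_{stdVec j} (G j)) w x) :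
    ∫ x, |w x| ^ p ≤ p ^ 2 * ((N * b) ^ 2 * ∫ x, ‖∇ w x‖ ^ 2 * |w x| ^ (p - 2)) := by
  have hA0 : 0 ≤ ∫ x, ‖∇ w x‖ ^ 2 * |w x| ^ (p - 2) := integral_nonneg fun x => by positivity
  rcases lt_or_ge p 2 with hp2 | hp2
  · exact (integral_rpow_le_energy_of_lt_two hN hp hp2 hw hwp hD hE hb hG hrep).trans
      (le_mul_of_one_le_left (by positivity) (one_le_pow₀ hp.le))
  · refine (integral_rpow_le_energy_of_two_le hN hp2 hw hwp hE hb hG hrep).trans ?_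
    gcongr
    linarith

end Energy

/-! ### Limits of integrals in L^q and L¹. -/

section Limits

variable {α : Type*} [MeasurableSpace α] {μ : Measure α} {p : ℝ}

/-- Dominated convergence in `L^q`. -/
theorem tendsto_eLpNorm_sub_of_dominated {q : ℝ} (hq : 0 < q) {f : ℕ → α → ℝ} {v b : α → ℝ}
    (hf : ∀ n, AEStronglyMeasurable (f n) μ) (hv : AEStronglyMeasurable v μ)
    (hb : MemLp b (ENNReal.ofReal q) μ) (hfb : ∀ n x, |f n x| ≤ b x) (hvb : ∀ x, |v x| ≤ b x)
    (hlim : ∀ x, Tendsto (fun n => f n x) atTop (𝓝 (v x))) :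
    Tendsto (fun n => eLpNorm (f n - v) (ENNReal.ofReal q) μ) atTop (𝓝 0) := by
  have h0 : ENNReal.ofReal q ≠ 0 := by simpa using hq
  simp_rw [eLpNorm_eq_lintegral_rpow_enorm_toReal h0 ENNReal.ofReal_ne_top,
    ENNReal.toReal_ofReal hq.le]
  have hb2 : ∫⁻ x, ‖(2 * b x : ℝ)‖ₑ ^ q ∂μ ≠ ⊤ := by
    have h := (hb.const_mul 2).2
    rw [eLpNorm_lt_top_iff_lintegral_rpow_enorm_lt_top h0 ENNReal.ofReal_ne_top,
      ENNReal.toReal_ofReal hq.le] at h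
    exact h.ne
  have key : Tendsto (fun n => ∫⁻ x, ‖(f n - v) x‖ₑ ^ q ∂μ) atTop (𝓝 (∫⁻ _, 0 ∂μ)) := by
    refine tendsto_lintegral_of_dominated_convergence' _
      (fun n => ((hf n).sub hv).enorm.pow_const q)
      (fun n => Eventually.of_forall fun x => ?_) hb2 (Eventually.of_forall fun x => ?_)
    · refine ENNReal.rpow_le_rpow ?_ hq.le
      rw [enorm_le_iff_norm_le]
      have h1 := hfb n x
      have h2 := hvb x
      have h3 := abs_sub (f n x) (v x)
      rw [Pi.sub_apply, Real.norm_eq_abs, Real.norm_eq_abs]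
      exact le_trans (by linarith) (le_abs_self _)
    · have h : Tendsto (fun n => ‖f n x - v x‖ₑ ^ q) atTop (𝓝 (‖v x - v x‖ₑ ^ q)) :=
        (((hlim x).sub_const (v x)).enorm).ennrpow_const q
      simpa [ENNReal.zero_rpow_of_pos hq] using h
  have h := key.ennrpow_const (1 / q)
  rwa [lintegral_zero, ENNReal.zero_rpow_of_pos (by positivity)] at h

theorem tendsto_integral_mul_of_tendsto_eLpNorm (hp : 1 < p) {f : ℕ → α → ℝ} {v g : α → ℝ}
    (hf : ∀ n, AEStronglyMeasurable (f n) μ) (hv : AEStronglyMeasurable v μ)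
    (hg : MemLp g (ENNReal.ofReal p) μ) (hfg : ∀ n, Integrable (fun x => f n x * g x) μ)
    (hlim : Tendsto (fun n => eLpNorm (f n - v) (ENNReal.ofReal p.conjExponent) μ) atTop (𝓝 0)) :
    Tendsto (fun n => ∫ x, f n x * g x ∂μ) atTop (𝓝 (∫ x, v x * g x ∂μ)) := by
  have hpq := (Real.HolderConjugate.conjExponent hp).symm.ennrealOfReal
  refine tendsto_integral_of_L1 _ (hv.mul hg.1) (Eventually.of_forall hfg) ?_
  have h := ENNReal.Tendsto.mul_const (b := eLpNorm g (ENNReal.ofReal p) μ) hlim (Or.inr hg.2.ne)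
  rw [zero_mul] at h
  refine tendsto_of_tendsto_of_tendsto_of_le_of_le tendsto_const_nhds h (fun _ => zero_le)
    fun n => ?_
  have := eLpNorm_smul_le_mul_eLpNorm (r := 1) (p := ENNReal.ofReal p.conjExponent)
    (q := ENNReal.ofReal p) hg.1 ((hf n).sub hv)
  rw [eLpNorm_one_eq_lintegral_enorm] at this
  refine le_trans (le_of_eq (lintegral_congr fun x => ?_)) this
  simp [sub_mul]

theorem tendsto_integral_mul_of_tendsto_lintegral {f : ℕ → α → ℝ} {h b : α → ℝ} {M : ℝ}
    (hf : ∀ n, Integrable (f n) μ) (hh : Integrable h μ) (hb : AEStronglyMeasurable b μ)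
    (hM : ∀ᵐ x ∂μ, |b x| ≤ M)
    (hlim : Tendsto (fun n => ∫⁻ x, ‖f n x - h x‖ₑ ∂μ) atTop (𝓝 0)) :
    Tendsto (fun n => ∫ x, b x * f n x ∂μ) atTop (𝓝 (∫ x, b x * h x ∂μ)) := by
  refine tendsto_integral_of_L1 _ (hb.mul hh.1)
    (Eventually.of_forall fun n => (hf n).bdd_mul hb hM) ?_
  have h := ENNReal.Tendsto.const_mul (a := ENNReal.ofReal M) hlim (Or.inr ENNReal.ofReal_ne_top)
  rw [mul_zero] at h
  refine tendsto_of_tendsto_of_tendsto_of_le_of_le tendsto_const_nhds h (fun _ => zero_le)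
    fun n => ?_
  simp only
  rw [← lintegral_const_mul' _ _ ENNReal.ofReal_ne_top]
  refine lintegral_mono_ae (hM.mono fun x hx => ?_)
  rw [Pi.mul_apply, ← mul_sub, enorm_mul]
  gcongr
  rw [← ofReal_norm]
  exact ENNReal.ofReal_le_ofReal hx

/-- Completeness of `L¹` for sequences of integrable functions. -/
theorem exists_integrable_tendsto_of_cauchy {f : ℕ → α → ℝ} (hf : ∀ n, Integrable (f n) μ)
    (hc : Tendsto (fun mn : ℕ × ℕ => ∫⁻ x, ‖f mn.1 x - f mn.2 x‖ₑ ∂μ) (atTop ×ˢ atTop) (𝓝 0)) :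
    ∃ h : α → ℝ, Integrable h μ ∧
      Tendsto (fun n => ∫⁻ x, ‖f n x - h x‖ₑ ∂μ) atTop (𝓝 0) := by
  have hcs : CauchySeq fun n => (hf n).toL1 (f n) := by
    rw [EMetric.cauchySeq_iff]
    intro ε hε
    have h := hc.eventually (gt_mem_nhds hε)
    rw [prod_atTop_atTop_eq, eventually_atTop_prod_self] at h
    obtain ⟨n₀, hn₀⟩ := h
    refine ⟨n₀, fun m hm n hn => ?_⟩
    rw [Integrable.edist_toL1_toL1]
    simpa only [edist_eq_enorm_sub] using hn₀ m n hm hn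
  obtain ⟨h, hh⟩ := cauchySeq_tendsto_of_complete hcs
  refine ⟨h, L1.integrable_coeFn h, ?_⟩
  have h2 := tendsto_iff_edist_tendsto_0.1 hh
  refine h2.congr fun n => ?_
  have h3 := Integrable.edist_toL1_toL1 (f n) h (hf n) (L1.integrable_coeFn h)
  rw [Integrable.toL1_coeFn] at h3
  simpa only [edist_eq_enorm_sub] using h3

end Limits

/-! ### The pairing of div (a ∇w) with the power of w. -/

section Pairing

variable {N : ℕ} {p : ℝ} {w : EuclideanSpace ℝ (Fin N) → ℝ}

theorem EuclideanSpace.norm_le_sum_abs (z : EuclideanSpace ℝ (Fin N)) : ‖z‖ ≤ ∑ j, |z j| := by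
  rw [EuclideanSpace.norm_eq]
  exact Real.sqrt_le_iff.2 ⟨Finset.sum_nonneg fun j _ => abs_nonneg _,
    Finset.sum_sq_le_sq_sum_of_nonneg fun j _ => abs_nonneg _⟩

theorem continuous_gradient {f : EuclideanSpace ℝ (Fin N) → ℝ} (hf : ContDiff ℝ ∞ f) :
    Continuous (∇ f) :=
  (InnerProductSpace.toDual ℝ (EuclideanSpace ℝ (Fin N))).symm.continuous.comp
    (hf.continuous_fderiv (by simp))

theorem integrable_rpow_sub_one_mul_gradient (hp : 1 < p) (hw : ContDiff ℝ ∞ w)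
    (hwp : MemLp w (ENNReal.ofReal p)) (hD : ∀ j, MemLp (pd j w) (ENNReal.ofReal p)) :
    Integrable fun x => |w x| ^ (p - 1) * ‖∇ w x‖ := by
  refine integrable_abs_rpow_sub_one_mul hp hwp
    (MemLp.mono (g := fun x => ∑ j, |pd j w x|) (memLp_finsetSum _ fun j _ => (hD j).abs)
      (continuous_gradient hw).norm.aestronglyMeasurable (Eventually.of_forall fun x => ?_))
  rw [norm_norm, Real.norm_eq_abs, abs_of_nonneg (Finset.sum_nonneg fun j _ => abs_nonneg _)]
  simpa only [gradient_apply_eq_pd] using EuclideanSpace.norm_le_sum_abs (∇ w x)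

/-- The power `|w|^(p-2) w` can be approximated by test functions, dominated by `|w|^(p-1)`, in
the sense required for the pairing with `div (a ∇w)`. -/
theorem exists_isDivApprox_power (hp : 1 < p) (hw : ContDiff ℝ ∞ w)
    (hwp : MemLp w (ENNReal.ofReal p)) (hD : ∀ j, MemLp (pd j w) (ENNReal.ofReal p))
    (hE : Integrable fun x => ‖∇ w x‖ ^ 2 * |w x| ^ (p - 2))
    {a : EuclideanSpace ℝ (Fin N) → ℝ} (ha : Measurable a) {M : ℝ} (hM : ∀ᵐ x, |a x| ≤ M) :
    ∃ φ : ℕ → EuclideanSpace ℝ (Fin N) → ℝ,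
      IsDivApprox (fun x => a x • ∇ w x) (ENNReal.ofReal p.conjExponent)
        (fun x => |w x| ^ (p - 2) * w x) φ ∧
      (∀ n x, |φ n x| ≤ |w x| ^ (p - 1)) ∧
      ∀ x, Tendsto (fun n => φ n x) atTop (𝓝 (|w x| ^ (p - 2) * w x)) := by
  obtain ⟨φ, C, hC, hφ, hφle, hφt, hφd, -, hφlim⟩ := exists_testFun_approx hp hw
  refine ⟨φ, ⟨hφ, ?_, ?_⟩, hφle, hφt⟩
  · refine tendsto_eLpNorm_sub_of_dominated (Real.HolderConjugate.conjExponent hp).symm.pos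
      (fun n => (hφ n).1.continuous.aestronglyMeasurable)
      (((hw.continuous.abs.measurable.pow_const _).mul
        hw.continuous.measurable).aestronglyMeasurable)
      (memLp_abs_rpow_sub_one hp hwp) hφle (fun x => (abs_abs_rpow_sub_two_mul hp (w x)).le) hφt
  · have hgrad : ∀ n x, ‖∇ (φ n) x‖
        ≤ N * C * (|w x| ^ (p - 2) * ‖∇ w x‖ + |w x| ^ (p - 1)) := fun n x => by
      refine (EuclideanSpace.norm_le_sum_abs _).trans ?_
      simp only [gradient_apply_eq_pd]
      have : ∀ j ∈ Finset.univ, |pd j (φ n) x|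
          ≤ C * (|w x| ^ (p - 2) * ‖∇ w x‖ + |w x| ^ (p - 1)) := fun j _ =>
        (hφd n j x).trans (by gcongr; exact abs_pd_le_norm_gradient w x j)
      refine (Finset.sum_le_card_nsmul _ _ _ this).trans (le_of_eq ?_)
      simp [mul_assoc]
    -- Dominates the integrand for all pairs of indices; the pointwise limit is 0 because both
    -- gradients tend almost everywhere to the same vector.
    set B : EuclideanSpace ℝ (Fin N) → ℝ := fun x => M * (2 * (N * C)) *
      (‖∇ w x‖ ^ 2 * |w x| ^ (p - 2) + |w x| ^ (p - 1) * ‖∇ w x‖) with hB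
    have iB : Integrable B :=
      (hE.add (integrable_rpow_sub_one_mul_gradient hp hw hwp hD)).const_mul _
    have hF : Measurable fun x => a x • ∇ w x := ha.smul (continuous_gradient hw).measurable
    have key : Tendsto (fun mn : ℕ × ℕ =>
        ∫⁻ x, ‖a x • ∇ w x‖ₑ * ‖∇ (φ mn.1) x - ∇ (φ mn.2) x‖ₑ) (atTop ×ˢ atTop)
        (𝓝 (∫⁻ _ : EuclideanSpace ℝ (Fin N), 0)) := by
      refine tendsto_lintegral_filter_of_dominated_convergence (fun x => ENNReal.ofReal (B x))
        (Eventually.of_forall fun mn => hF.enorm.mul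
          ((continuous_gradient (hφ mn.1).1).sub (continuous_gradient (hφ mn.2).1)).measurable.enorm)
        (Eventually.of_forall fun mn => hM.mono fun x hx => ?_) iB.lintegral_lt_top.ne ?_
      · rw [← ofReal_norm, ← ofReal_norm, ← ENNReal.ofReal_mul (norm_nonneg _)]
        refine ENNReal.ofReal_le_ofReal ?_
        have h1 := hgrad mn.1 x
        have h2 := hgrad mn.2 x
        have h3 := norm_sub_le (∇ (φ mn.1) x) (∇ (φ mn.2) x)
        have hM0 : 0 ≤ M := (abs_nonneg _).trans hx
        rw [norm_smul, Real.norm_eq_abs]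
        calc |a x| * ‖∇ w x‖ * ‖∇ (φ mn.1) x - ∇ (φ mn.2) x‖
            ≤ M * ‖∇ w x‖ *
              (2 * (N * C * (|w x| ^ (p - 2) * ‖∇ w x‖ + |w x| ^ (p - 1)))) := by
              gcongr
              linarith
          _ = B x := by rw [hB]; ring
      · filter_upwards [ae_all_iff.2 fun j => ae_pd_eq_zero_of_eq_zero hw j] with x hx
        have h0 : Tendsto (fun mn : ℕ × ℕ => ∇ (φ mn.1) x - ∇ (φ mn.2) x) (atTop ×ˢ atTop)
            (𝓝 0) := by
          refine squeeze_zero_norm (fun mn => EuclideanSpace.norm_le_sum_abs _) ?_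
          rw [← Finset.sum_const_zero (s := (Finset.univ : Finset (Fin N))) (M := ℝ)]
          refine tendsto_finsetSum _ fun j _ => ?_
          have h := (((hφlim j x (hx j)).comp tendsto_fst).sub
            ((hφlim j x (hx j)).comp tendsto_snd) : Tendsto _ (atTop ×ˢ atTop) _).abs
          rw [sub_self, abs_zero] at h
          refine h.congr fun mn => ?_
          simp [gradient_apply_eq_pd]
        have h1 := ENNReal.Tendsto.const_mul (a := ‖a x • ∇ w x‖ₑ) h0.enorm
          (Or.inr enorm_ne_top)
        simpa using h1
    simpa using key

theorem hasCompactSupport_sum_pd_mul {ψ : EuclideanSpace ℝ (Fin N) → ℝ} (hψ : HasCompactSupport ψ)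
    (V : Fin N → EuclideanSpace ℝ (Fin N) → ℝ) :
    HasCompactSupport fun x => ∑ j, pd j (fun y => ψ y * V j y) x := by
  refine hψ.mono' (Function.support_subset_iff'.2 fun x hx => Finset.sum_eq_zero fun j _ => ?_)
  have : x ∉ tsupport fun y => ψ y * V j y := fun h =>
    hx (closure_mono (Function.support_mul_subset_left _ _) h)
  rw [pd, fderiv_of_notMem_tsupport ℝ this]
  rfl

/-- The weak chain rule for the field ψ∇w. Compact support supplies the first two integrability
conditions; the third, with the weight |w|^(p-2), is the finiteness of the energy. It identifies the
L¹ limit of ∇w·∇φ_n. -/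
theorem integral_smul_energy (hp : 1 < p) (hw : ContDiff ℝ ∞ w)
    (hE : Integrable fun x => ‖∇ w x‖ ^ 2 * |w x| ^ (p - 2))
    {ψ : EuclideanSpace ℝ (Fin N) → ℝ} (hψ : ContDiff ℝ ∞ ψ) (hψc : HasCompactSupport ψ) :
    ∫ x, |w x| ^ (p - 2) * w x * ∑ j, pd j (fun y => ψ y * pd j w y) x
      = -∫ x, ψ x * ((p - 1) * (‖∇ w x‖ ^ 2 * |w x| ^ (p - 2))) := by
  have hV : ∀ j, ContDiff ℝ ∞ fun y => ψ y * pd j w y := fun j => hψ.mul (contDiff_pd hw j)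
  have hVc : ∀ j, HasCompactSupport fun y => ψ y * pd j w y := fun j => hψc.mul_right
  have hdc := hasCompactSupport_sum_pd_mul hψc fun j => pd j w
  have hwc : Continuous fun x => |w x| ^ (p - 1) :=
    hw.continuous.abs.rpow_const fun x => Or.inr (by linarith)
  obtain ⟨K, hK⟩ := hψc.exists_bound_of_continuous hψ.continuous
  have h3 : ∀ j, Integrable fun x => |w x| ^ (p - 2) * |pd j w x| * |ψ x * pd j w x| := fun j => by
    refine ((integrable_energy_pd hw hE j).bdd_mul hψ.continuous.abs.aestronglyMeasurable
      (Eventually.of_forall fun x => (norm_norm (ψ x)).trans_le (hK x))).congr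
      (Eventually.of_forall fun x => ?_)
    simp only [abs_mul]
    rw [← sq_abs]
    ring
  rw [integral_power_mul_div hp hw hV
    ((hwc.mul (continuous_finsetSum _ fun j _ =>
      (contDiff_pd (hV j) j).continuous).abs).integrable_of_hasCompactSupport
        (hdc.abs.mul_left))
    (fun j => (hwc.mul (hV j).continuous.abs).integrable_of_hasCompactSupport
      ((hVc j).abs.mul_left)) h3]
  congr 1
  refine integral_congr_ae (Eventually.of_forall fun x => ?_)
  simp only
  rw [norm_gradient_sq, Finset.sum_mul, Finset.mul_sum, Finset.mul_sum]
  exact Finset.sum_congr rfl fun j _ => by ring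

/-- Along an approximation of `|w|^(p-2) w` by test functions, `⟨div (a ∇w), φ n⟩` converges. -/
theorem IsDivApprox.tendsto_divAction (hp : 1 < p) (hw : ContDiff ℝ ∞ w)
    (hE : Integrable fun x => ‖∇ w x‖ ^ 2 * |w x| ^ (p - 2))
    {a : EuclideanSpace ℝ (Fin N) → ℝ} (ha : Measurable a) {M s : ℝ} (hM : ∀ᵐ x, |a x| ≤ M)
    (hs : 0 < s) (hsa : ∀ᵐ x, s ≤ a x) {φ : ℕ → EuclideanSpace ℝ (Fin N) → ℝ}
    (hφ : IsDivApprox (fun x => a x • ∇ w x) (ENNReal.ofReal p.conjExponent)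
      (fun x => |w x| ^ (p - 2) * w x) φ) :
    Tendsto (fun n => divAction (fun x => a x • ∇ w x) (φ n)) atTop
      (𝓝 (-((p - 1) * ∫ x, a x * ‖∇ w x‖ ^ 2 * |w x| ^ (p - 2)))) := by
  obtain ⟨hφs, hφq, hφc⟩ := hφ
  set H : ℕ → EuclideanSpace ℝ (Fin N) → ℝ := fun n x => inner ℝ (∇ w x) (∇ (φ n) x) with hH
  have hHsum : ∀ n x, H n x = ∑ j, pd j (φ n) x * pd j w x := fun n x => by
    rw [hH]; simp only; rw [real_inner_comm, inner_gradient_eq_sum]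
  have iH : ∀ n, Integrable (H n) := fun n => by
    rw [show H n = fun x => ∑ j, pd j (φ n) x * pd j w x from funext (hHsum n)]
    exact integrable_finsetSum _ fun j _ =>
      ((contDiff_pd (hφs n).1 j).continuous.mul
        (contDiff_pd hw j).continuous).integrable_of_hasCompactSupport
        ((hφs n).2.fderiv_apply ℝ (stdVec j)).mul_right
  -- The lower bound on a removes the weight: |∇w·(∇φ_m - ∇φ_n)| ≤ s⁻¹ |a∇w| |∇φ_m - ∇φ_n|.
  have hcauchy : Tendsto (fun mn : ℕ × ℕ => ∫⁻ x, ‖H mn.1 x - H mn.2 x‖ₑ) (atTop ×ˢ atTop)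
      (𝓝 0) := by
    have h := ENNReal.Tendsto.const_mul (a := ENNReal.ofReal s⁻¹) hφc
      (Or.inr ENNReal.ofReal_ne_top)
    rw [mul_zero] at h
    refine tendsto_of_tendsto_of_tendsto_of_le_of_le tendsto_const_nhds h (fun _ => zero_le)
      fun mn => ?_
    simp only
    rw [← lintegral_const_mul' _ _ ENNReal.ofReal_ne_top]
    refine lintegral_mono_ae (hsa.mono fun x hx => ?_)
    rw [← ofReal_norm, ← ofReal_norm, ← ofReal_norm, ← ENNReal.ofReal_mul (norm_nonneg _),
      ← ENNReal.ofReal_mul (by positivity)]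
    refine ENNReal.ofReal_le_ofReal ?_
    rw [hH]
    simp only
    rw [← inner_sub_right, norm_smul, Real.norm_of_nonneg (hs.le.trans hx), ← mul_assoc,
      ← mul_assoc]
    refine (norm_inner_le_norm _ _).trans ?_
    have h1 : 1 ≤ s⁻¹ * a x := by rwa [inv_mul_eq_div, one_le_div hs]
    rw [mul_assoc (s⁻¹ * a x)]
    exact le_mul_of_one_le_left (by positivity) h1
  obtain ⟨h, ih, hlim⟩ := exists_integrable_tendsto_of_cauchy iH hcauchy
  -- Tested against ψ, ∫ψ ∇w·∇φ_n = -∫φ_n div (ψ∇w), where L^q convergence of φ_n alone gives the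
  -- limit.
  have hae : ∀ᵐ x, h x = (p - 1) * (‖∇ w x‖ ^ 2 * |w x| ^ (p - 2)) := by
    refine ae_eq_of_integral_contDiff_smul_eq ih.locallyIntegrable
      (hE.const_mul (p - 1)).locallyIntegrable fun ψ hψ hψc => ?_
    have hψ' : ContDiff ℝ ∞ ψ := hψ
    simp only [smul_eq_mul]
    have hV : ∀ j, ContDiff ℝ ∞ fun y => ψ y * pd j w y := fun j => hψ'.mul (contDiff_pd hw j)
    have hdiv : Continuous fun x => ∑ j, pd j (fun y => ψ y * pd j w y) x :=
      continuous_finsetSum _ fun j _ => (contDiff_pd (hV j) j).continuous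
    have hdc := hasCompactSupport_sum_pd_mul hψc fun j => pd j w
    have t1 : Tendsto (fun n => ∫ x, φ n x * ∑ j, pd j (fun y => ψ y * pd j w y) x) atTop
        (𝓝 (∫ x, |w x| ^ (p - 2) * w x * ∑ j, pd j (fun y => ψ y * pd j w y) x)) :=
      tendsto_integral_mul_of_tendsto_eLpNorm hp
        (fun n => (hφs n).1.continuous.aestronglyMeasurable)
        (((hw.continuous.abs.measurable.pow_const _).mul
          hw.continuous.measurable).aestronglyMeasurable)
        (hdiv.memLp_of_hasCompactSupport hdc)
        (fun n => ((hφs n).1.continuous.mul hdiv).integrable_of_hasCompactSupport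
          (hφs n).2.mul_right) hφq
    obtain ⟨K, hK⟩ := hψc.exists_bound_of_continuous hψ.continuous
    have t2 : Tendsto (fun n => ∫ x, ψ x * H n x) atTop (𝓝 (∫ x, ψ x * h x)) :=
      tendsto_integral_mul_of_tendsto_lintegral iH ih hψ.continuous.aestronglyMeasurable
        (Eventually.of_forall hK) hlim
    have e : ∀ n, ∫ x, ψ x * H n x
        = -∫ x, φ n x * ∑ j, pd j (fun y => ψ y * pd j w y) x := fun n => by
      rw [← integral_sum_pd_mul (hφs n).1 (hφs n).2 hV]
      refine integral_congr_ae (Eventually.of_forall fun x => ?_)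
      simp only
      rw [hHsum, Finset.mul_sum]
      exact Finset.sum_congr rfl fun j _ => by ring
    rw [integral_smul_energy hp hw hE hψ' hψc] at t1
    have t3 := t1.neg
    rw [neg_neg] at t3
    exact tendsto_nhds_unique t2 (t3.congr fun n => (e n).symm)
  -- The coefficient a comes back here; only its boundedness is needed.
  have t := (tendsto_integral_mul_of_tendsto_lintegral iH ih ha.aestronglyMeasurable hM hlim).neg
  have e1 : ∫ x, a x * h x = (p - 1) * ∫ x, a x * ‖∇ w x‖ ^ 2 * |w x| ^ (p - 2) := by
    rw [← integral_const_mul]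
    refine integral_congr_ae (hae.mono fun x hx => ?_)
    simp only [hx]
    ring
  rw [e1] at t
  refine t.congr fun n => ?_
  rw [divAction]
  congr 1
  refine integral_congr_ae (Eventually.of_forall fun x => ?_)
  simp only [hH, real_inner_smul_left]

end Pairing

/-! ### Assembly of the inequality and the two forms of the equality. -/

theorem mainTheorem9 (N : ℕ) (hN : 1 ≤ N) (κ : ℝ) (hκ : 1 < κ) :
    ∃ c : ℝ, 0 < c ∧
      ∀ (p : ℝ) (hp : 1 < p) (R₁ R₂ : ℝ), 0 < R₁ → R₂ / R₁ = κ →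
      ∀ (u : EuclideanSpace ℝ (Fin N) → ℝ) (hu : MemLp u (ENNReal.ofReal p) volume),
        fourierSupport (lpDistribution hp u hu) ⊆ frequencyAnnulus N R₁ R₂ →
        -- `w` is the smooth representative of `u`
        ∃ w : EuclideanSpace ℝ (Fin N) → ℝ, ContDiff ℝ ∞ w ∧ u =ᵐ[volume] w ∧
          ∀ (a : EuclideanSpace ℝ (Fin N) → ℝ) (aStar : ℝ),
            Measurable a → (∃ M : ℝ, ∀ᵐ x, |a x| ≤ M) → 0 < aStar → (∀ᵐ x, aStar ≤ a x) →
            Integrable (fun x => |w x| ^ p) volume ∧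
            Integrable (fun x => a x * ‖∇ w x‖ ^ 2 * |w x| ^ (p - 2)) volume ∧
            c * aStar * ((p - 1) / p ^ 2) * R₁ ^ 2 * ∫ x, |w x| ^ p
              ≤ (p - 1) * ∫ x, a x * ‖∇ w x‖ ^ 2 * |w x| ^ (p - 2) ∧
            -- the equality, with `div (a ∇u)` as a distribution
            HasDivPairing (fun x => a x • ∇ w x) (ENNReal.ofReal (p / (p - 1)))
              (fun x => |w x| ^ (p - 2) * w x)
              (-((p - 1) * ∫ x, a x * ‖∇ w x‖ ^ 2 * |w x| ^ (p - 2))) ∧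
            -- the equality, with a Lebesgue integral, when `div (a ∇u)` is a function `g`
            ∀ g : EuclideanSpace ℝ (Fin N) → ℝ, IsDistribDiv (fun x => a x • ∇ w x) g →
              Integrable (fun x => g x * (|w x| ^ (p - 2) * w x)) volume →
              (p - 1) * ∫ x, a x * ‖∇ w x‖ ^ 2 * |w x| ^ (p - 2)
                = -∫ x, g x * (|w x| ^ (p - 2) * w x) := by
  obtain ⟨C, hC, hker⟩ := exists_reproducing_kernel N hκ
  have hN0 : (0 : ℝ) < N := by exact_mod_cast hN
  -- With b = C/R₁ the inequality X ≤ p²(Nb)²A reads (NC)⁻² p⁻² R₁² X ≤ A.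
  refine ⟨((N * C) ^ 2)⁻¹, by positivity, fun p hp R₁ R₂ hR hRκ u hu hsupp => ?_⟩
  have hR2 : R₂ = κ * R₁ := (div_eq_iff hR.ne').1 hRκ
  obtain ⟨G, hG, hrep⟩ := hker R₁ hR
  have huw := hrep p hp u hu (hR2 ▸ hsupp)
  have hp0 : 0 < p := by linarith
  generalize hK : (∑ j : Fin N, LineDeriv.lineDerivOp (stdVec j) (G j) :
    𝓢(EuclideanSpace ℝ (Fin N), ℝ)) = K at huw
  set w := schwartzConv K u with hwdef
  have hw : ContDiff ℝ ∞ w := contDiff_schwartzConv hp hu K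
  have hwp : MemLp w (ENNReal.ofReal p) := memLp_schwartzConv hp hu K
  have hpd : ∀ (L : 𝓢(EuclideanSpace ℝ (Fin N), ℝ)) j, pd j (schwartzConv L u)
      = schwartzConv (LineDeriv.lineDerivOp (stdVec j) L) u := fun L j =>
    funext fun x => fderiv_schwartzConv_apply hp hu L x (stdVec j)
  have hD : ∀ j, MemLp (pd j w) (ENNReal.ofReal p) := fun j => by
    rw [hwdef, hpd]
    exact memLp_schwartzConv hp hu _
  have hL : MemLp (fun x => ∑ j, pd j (pd j w) x) (ENNReal.ofReal p) := by
    refine memLp_finsetSum _ fun j _ => ?_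
    rw [hwdef, hpd, hpd]
    exact memLp_schwartzConv hp hu _
  have hE := integrable_energy hp hw hwp hD hL
  -- Since w = K * u and u = w almost everywhere, w = K * w holds at every point.
  have hineq := integral_rpow_le_energy hN hp hw hwp hD hE (div_pos hC hR) hG fun x => by
    rw [hK, ← schwartzConv_congr_ae K huw]
  have habs : ∀ x, |(|w x| ^ (p - 2) * w x)| = |w x| ^ (p - 1) := fun x =>
    abs_abs_rpow_sub_two_mul hp (w x)
  refine ⟨w, hw, huw, fun a aStar ha ⟨M, hM⟩ hs hsa => ?_⟩
  have hEa : Integrable fun x => a x * ‖∇ w x‖ ^ 2 * |w x| ^ (p - 2) := by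
    simpa only [mul_assoc] using hE.bdd_mul ha.aestronglyMeasurable hM
  obtain ⟨φ, hφ, hφle, hφt⟩ := exists_isDivApprox_power hp hw hwp hD hE ha hM
  refine ⟨hwp.integrable_norm_rpow_ofReal hp, hEa, ?_, ⟨⟨φ, hφ⟩, fun φ' hφ' =>
    hφ'.tendsto_divAction hp hw hE ha hM hs hsa⟩, fun g hg hgi => ?_⟩
  · have h1 : aStar * ∫ x, ‖∇ w x‖ ^ 2 * |w x| ^ (p - 2)
        ≤ ∫ x, a x * ‖∇ w x‖ ^ 2 * |w x| ^ (p - 2) := by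
      rw [← integral_const_mul]
      refine integral_mono_ae (hE.const_mul _) hEa (hsa.mono fun x hx => ?_)
      simp only [mul_assoc]
      gcongr
    refine le_trans ?_ (mul_le_mul_of_nonneg_left h1 (by linarith : 0 ≤ p - 1))
    calc ((N * C) ^ 2)⁻¹ * aStar * ((p - 1) / p ^ 2) * R₁ ^ 2 * ∫ x, |w x| ^ p
        ≤ ((N * C) ^ 2)⁻¹ * aStar * ((p - 1) / p ^ 2) * R₁ ^ 2 *
          (p ^ 2 * ((N * (C / R₁)) ^ 2 * ∫ x, ‖∇ w x‖ ^ 2 * |w x| ^ (p - 2))) := by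
          have : 0 ≤ p - 1 := by linarith
          gcongr
      _ = (p - 1) * (aStar * ∫ x, ‖∇ w x‖ ^ 2 * |w x| ^ (p - 2)) := by
          field_simp
  · have t1 := hφ.tendsto_divAction hp hw hE ha hM hs hsa
    -- This uses the constructed approximation, not an arbitrary one: |φ_n| ≤ |w|^(p-1) makes |g|
    -- |w|^(p-1) an integrable majorant.
    have t2 : Tendsto (fun n => ∫ x, g x * φ n x) atTop
        (𝓝 (∫ x, g x * (|w x| ^ (p - 2) * w x))) := by
      refine tendsto_integral_of_dominated_convergence _
        (fun n => hg.1.aestronglyMeasurable.mul (hφ.1 n).1.continuous.aestronglyMeasurable)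
        hgi.norm (fun n => Eventually.of_forall fun x => ?_)
        (Eventually.of_forall fun x => (hφt x).const_mul _)
      rw [norm_mul, norm_mul, Real.norm_eq_abs (φ n x), Real.norm_eq_abs (_ * w x), habs]
      gcongr
      exact hφle n x
    have e := tendsto_nhds_unique t1 (t2.congr fun n => hg.2 _ (hφ.1 n))
    linarith
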